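/- Let $U\subseteq\mathbb R^2$ be open, connected and nonempty, with coordinates $(u^1,u^2)$. For smooth functions $g^{ij}=g^{ji}$ and $\Gamma^{ij}_k$ on $U$ put $$P_1=g^{ij}(u)\partial_x+\Gamma^{ij}_k(u)u^k_x,\qquad R_3^{(1)}=\begin{pmatrix}0&1\\1&0\end{pmatrix}\partial_x^3 .$$ $P_1$ is called compatible with $R_3^{(1)}$ if $[P_1,R_3^{(1)}]=0$ (Schouten bracket), that is, if for $P=P_1$, $R=R_3^{(1)}$ $$\int\Big(\psi_1\cdot\big(P'_u[R\psi_2]\psi_3+R'_u[P\psi_2]\psi_3\big)+\text{cyclic permutations of }(\psi_1,\psi_2,\psi_3)\Big)dx=0$$ for all smooth $u:\mathbb R\to U$ and all smooth compactly supported $\psi_1,\psi_2,\psi_3:\mathbb R\to\mathbb R^2$, where $P'_u[w]$ is the derivative of $P$ at $u$ in the direction $w$. For $c=(c_1,\dots,c_7)\in\mathbb R^7$ let $g_c$ be the symmetric contravariant tensor with $$g^{11}=c_1u^1+c_2u^2+c_3,\quad g^{12}=c_4u^1+c_1u^2+c_5,\quad g^{22}=c_6u^1+c_4u^2+c_7 .$$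 A contravariant tensor $g$ is called flat if the Levi-Civita connection of $(g^{ij})^{-1}$ has zero curvature wherever $\det(g^{ij})\neq0$. For $g,h$ with $\det g\not\equiv0$, $\det h\not\equiv 0$ on $U$, $g-\lambda h$ is called a flat pencil if for every $\lambda\in\mathbb R$ the tensor $g-\lambda h$ is flat and, where $g$, $h$ and $g-\lambda h$ are all nondegenerate, the contravariant Christoffel symbols $\Gamma^{ij}_k=-g^{is}\Gamma^j_{sk}$ satisfy $\Gamma^{ij}_k(g-\lambda h)=\Gamma^{ij}_k(g)-\lambda\,\Gamma^{ij}_k(h)$. **Theorem.** (a) $P_1$ is compatible with $R_3^{(1)}$ if and only if $g=g_c$ on $U$ for some $c\in\mathbb R^7$ and $\Gamma^{ij}_k=\tfrac12\partial_kg^{ij}$. If $P_1$ is compatible with $R_3^{(1)}$ and $g=g_c$, then the Levi-Civita conditions $$g^{is}\Gamma^{jk}_s=g^{js}\Gamma^{ik}_s,\qquad \Gamma^{ij}_k+\Gamma^{ji}_k=\partial_kg^{ij}$$ hold on $U$ if and only if $$c_1c_4-c_2c_6=0,\qquad c_3c_4-c_7c_2=0,\qquad c_3c_6-c_1c_7=0,\tag{V}$$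 and (V) implies that $g$ is flat. (b) $c$ satisfies (V) if and only if it is in one of the following cases: 1. $c_2\ne0$, $c_6=c_4c_1/c_2$, $c_7=c_3c_4/c_2$; 2. $c_2=0$, $c_3\neq0$, $c_6=c_7c_1/c_3$, $c_4=0$; 3. $c_1=c_2=c_3=0$; 4. $c_2=c_3=0$, $c_1\ne0$, $c_4=c_7=0$. (c) If $c,d$ satisfy (V) and $\det g_c\not\equiv0$, $\det g_d\not\equiv0$ on $U$, then $g_c-\lambda g_d$ is a flat pencil if and only if $c-\lambda d$ satisfies (V) for every $\lambda\in\mathbb R$. (d) Let $c$ be in case $k$ and $d$ in case $l$. If $\det g_c\not\equiv0$ and $\det g_d\not\equiv0$ on $U$, then $g_c-\lambda g_d$ is a flat pencil if and only if the condition for $(k,l)$ below holds. Also without these two assumptions, $c-\lambda d$ satisfies (V) for every $\lambda\in\mathbb R$ if and only if the same condition holds. - $(1,1)$: $c_4=\frac{d_4c_2}{d_2}$, or both $d_3=\frac{d_2c_3}{c_2}$ and $c_1=\frac{d_1c_2}{d_2}$; - $(1,2)$: $d_7=\frac{d_3c_4}{c_2}$; - $(1,3)$: $d_6=\frac{d_4c_1}{c_2}$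 and $d_7=\frac{d_4c_3}{c_2}$; - $(1,4)$: $d_6=\frac{c_4d_1}{c_2}$; - $(2,2)$: $d_7=\frac{d_3c_7}{c_3}$ or $d_1=\frac{d_3c_1}{c_3}$; - $(2,3)$: $d_4=0$ and $d_6=\frac{d_7c_1}{c_3}$; - $(2,4)$: $d_6=\frac{c_7d_1}{c_3}$; - $(3,3)$: no condition; - $(3,4)$: $c_4=c_7=0$; - $(4,4)$: no condition. -/

import Mathlib

open scoped ContDiff

namespace KdVTrio

/-! ### Contravariant metrics on a domain of the plane -/

/-- Points `(u¹, u²)`; the two coordinates are indexed by `0` and `1`. -/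
abbrev Coord := Fin 2 → ℝ

/-- The partial derivative of `f` with respect to the `k`-th coordinate. -/
noncomputable def pd (k : Fin 2) (f : Coord → ℝ) (u : Coord) : ℝ :=
  fderiv ℝ f u (Pi.single k 1)

/-- Contravariant two-tensors `g^{ij}(u)`; the covariant tensor `g_{ij}` is the inverse matrix. -/
abbrev ContraTensor := Coord → Matrix (Fin 2) (Fin 2) ℝ

/-- Coefficients `Γ^{ij}_k(u)`, written `Γ u i j k`. -/
abbrev ContraSymbols := Coord → Fin 2 → Fin 2 → Fin 2 → ℝ

/-- The Christoffel symbols `Γ^i_{jk}` of the Levi-Civita connection of the metric with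
contravariant components `g`, meaningful where `g` is invertible. -/
noncomputable def christoffel (g : ContraTensor) (i j k : Fin 2) (u : Coord) : ℝ :=
  1 / 2 * ∑ l, g u i l * (pd j (fun v => (g v)⁻¹ l k) u + pd k (fun v => (g v)⁻¹ l j) u
    - pd l (fun v => (g v)⁻¹ j k) u)

/-- The contravariant Christoffel symbols `Γ^{ij}_k = - g^{is} Γ^j_{sk}`. -/
noncomputable def contraChristoffel (g : ContraTensor) (i j k : Fin 2) (u : Coord) : ℝ :=
  -∑ s, g u i s * christoffel g j s k u

/-- The Riemann curvature tensor `R^i_{jkl}` of the Levi-Civita connection of `g`. -/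
noncomputable def riemann (g : ContraTensor) (i j k l : Fin 2) (u : Coord) : ℝ :=
  pd k (christoffel g i l j) u - pd l (christoffel g i k j) u
    + ∑ m, (christoffel g i k m u * christoffel g m l j u
      - christoffel g i l m u * christoffel g m k j u)

/-- `g` is flat on `U`: its curvature vanishes at every point of `U` where it is a metric, that
is, where it is nondegenerate. -/
def FlatOn (U : Set Coord) (g : ContraTensor) : Prop :=
  ∀ u ∈ U, (g u).det ≠ 0 → ∀ i j k l, riemann g i j k l u = 0

/-- `g` is not identically degenerate on `U`. -/
def NondegenerateOn (U : Set Coord) (g : ContraTensor) : Prop :=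
  ∃ u ∈ U, (g u).det ≠ 0

/-- The Levi-Civita conditions for `g^{ij}` and `Γ^{ij}_k`:
`g^{is} Γ^{jk}_s = g^{js} Γ^{ik}_s` and `Γ^{ij}_k + Γ^{ji}_k = ∂_k g^{ij}`. -/
def LeviCivitaOn (U : Set Coord) (g : ContraTensor) (Γ : ContraSymbols) : Prop :=
  (∀ u ∈ U, ∀ i j k, ∑ s, g u i s * Γ u j k s = ∑ s, g u j s * Γ u i k s) ∧
  (∀ u ∈ U, ∀ i j k, Γ u i j k + Γ u j i k = pd k (fun v => g v i j) u)

/-- `g - λ h` is a flat pencil on `U`: every member is flat, and the contravariant Christoffel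
symbols of `g - λ h` are the pencil of those of `g` and `h` (wherever the metrics involved are
nondegenerate). -/
def FlatPencilOn (U : Set Coord) (g h : ContraTensor) : Prop :=
  (∀ lam : ℝ, FlatOn U (fun u => g u - lam • h u)) ∧
  (∀ lam : ℝ, ∀ u ∈ U, (g u).det ≠ 0 → (h u).det ≠ 0 → (g u - lam • h u).det ≠ 0 →
    ∀ i j k, contraChristoffel (fun v => g v - lam • h v) i j k u
      = contraChristoffel g i j k u - lam * contraChristoffel h i j k u)

/-! ### Differential operators depending on a field, and their Schouten bracket -/

/-- Two-component functions of the independent variable `x`. -/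
abbrev Fields := ℝ → Fin 2 → ℝ

/-- Matrix differential operators in `x` whose coefficients depend on a field `u` and its
derivatives: `P u ψ` is the result of applying the operator at the field `u` to `ψ`. -/
abbrev DiffOp := Fields → Fields → Fields

/-- The first-order homogeneous operator `g^{ij} ∂_x + Γ^{ij}_k u^k_x`. -/
noncomputable def hydroOp (g : ContraTensor) (Γ : ContraSymbols) : DiffOp := fun u ψ x i =>
  ∑ j, (g (u x) i j * deriv (fun y => ψ y j) x
    + (∑ k, Γ (u x) i j k * deriv (fun y => u y k) x) * ψ x j)

/-- The third-order operator with matrix `(0 1; 1 0) ∂_x³`. -/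
noncomputable def R3 : DiffOp := fun _ ψ x i =>
  ∑ j, (!![0, 1; 1, 0] : Matrix (Fin 2) (Fin 2) ℝ) i j * iteratedDeriv 3 (fun y => ψ y j) x

/-- The variation of `P ψ` at the field `u` in the direction `w`. -/
noncomputable def variation (P : DiffOp) (u w ψ : Fields) : Fields := fun x i =>
  deriv (fun ε : ℝ => P (u + ε • w) ψ x i) 0

/-- The term `ψ₁ · (P'_u[Q ψ₂] ψ₃ + Q'_u[P ψ₂] ψ₃)` of the Schouten bracket. -/
noncomputable def bracketTerm (P Q : DiffOp) (u ψ₁ ψ₂ ψ₃ : Fields) (x : ℝ) : ℝ :=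
  ∑ i, ψ₁ x i * (variation P u (Q u ψ₂) ψ₃ x i + variation Q u (P u ψ₂) ψ₃ x i)

/-- `[P, Q] = 0` over fields with values in `U`: the trivector
`∫ (ψ₁ · (P'[Q ψ₂] ψ₃ + Q'[P ψ₂] ψ₃) + cyclic) dx` vanishes for every smooth field `u` and all
smooth compactly supported `ψ₁, ψ₂, ψ₃`. For skew-adjoint `P` and `Q` this is the mixed part of
the Jacobi identity for the brackets `∫ δF/δu · (P + λ Q) δG/δu dx`. -/
def Compatible (U : Set Coord) (P Q : DiffOp) : Prop :=
  ∀ u : Fields, ContDiff ℝ ∞ u → (∀ x, u x ∈ U) →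
    ∀ ψ₁ ψ₂ ψ₃ : Fields, ContDiff ℝ ∞ ψ₁ → HasCompactSupport ψ₁ →
      ContDiff ℝ ∞ ψ₂ → HasCompactSupport ψ₂ → ContDiff ℝ ∞ ψ₃ → HasCompactSupport ψ₃ →
      ∫ x, (bracketTerm P Q u ψ₁ ψ₂ ψ₃ x + bracketTerm P Q u ψ₂ ψ₃ ψ₁ x
        + bracketTerm P Q u ψ₃ ψ₁ ψ₂ x) = 0

/-! ### The seven-parameter family of metrics -/

/-- The seven constant parameters of a metric. -/
@[ext]
structure Params where
  c1 : ℝ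
  c2 : ℝ
  c3 : ℝ
  c4 : ℝ
  c5 : ℝ
  c6 : ℝ
  c7 : ℝ

/-- `g¹¹ = c₁u¹ + c₂u² + c₃`, `g¹² = c₄u¹ + c₁u² + c₅`, `g²² = c₆u¹ + c₄u² + c₇`. -/
def Params.metric (c : Params) : ContraTensor := fun u =>
  !![c.c1 * u 0 + c.c2 * u 1 + c.c3, c.c4 * u 0 + c.c1 * u 1 + c.c5;
     c.c4 * u 0 + c.c1 * u 1 + c.c5, c.c6 * u 0 + c.c4 * u 1 + c.c7]

/-- The algebraic variety of the quadratic conditions on the parameters. -/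
def Params.InVariety (c : Params) : Prop :=
  c.c1 * c.c4 - c.c2 * c.c6 = 0 ∧ c.c3 * c.c4 - c.c7 * c.c2 = 0 ∧ c.c3 * c.c6 - c.c1 * c.c7 = 0

/-- The parameters `c - λ d`. -/
def Params.pencil (c d : Params) (lam : ℝ) : Params :=
  ⟨c.c1 - lam * d.c1, c.c2 - lam * d.c2, c.c3 - lam * d.c3, c.c4 - lam * d.c4,
    c.c5 - lam * d.c5, c.c6 - lam * d.c6, c.c7 - lam * d.c7⟩

def Params.Case1 (c : Params) : Prop :=
  c.c2 ≠ 0 ∧ c.c6 = c.c4 * c.c1 / c.c2 ∧ c.c7 = c.c3 * c.c4 / c.c2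

def Params.Case2 (c : Params) : Prop :=
  c.c2 = 0 ∧ c.c3 ≠ 0 ∧ c.c6 = c.c7 * c.c1 / c.c3 ∧ c.c4 = 0

def Params.Case3 (c : Params) : Prop :=
  c.c3 = 0 ∧ c.c2 = 0 ∧ c.c1 = 0

def Params.Case4 (c : Params) : Prop :=
  c.c3 = 0 ∧ c.c2 = 0 ∧ c.c1 ≠ 0 ∧ c.c4 = 0 ∧ c.c7 = 0

/-- The line through `c` with direction `d` lies in the variety. -/
def LineInVariety (c d : Params) : Prop :=
  ∀ lam : ℝ, (c.pencil d lam).InVariety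

/-- `g_c - λ g_d` is a flat pencil of metrics on `U`. -/
def FlatParams (U : Set Coord) (c d : Params) : Prop :=
  FlatPencilOn U c.metric d.metric

end KdVTrio

open KdVTrio

/-!
The operator `R3` does not depend on the field, so the Schouten bracket of `P = g ∂ₓ + Γ uₓ` with
it is the cyclic sum of `ψ₁ · P'[R ψ₂] ψ₃`, a trilinear form in the test functions with
coefficients `∂g`, `∂Γ uₓ` and `Γ` along the field, the index being transported by the matrix of
`R3` (`bracketTerm_cyclic`). Moving all derivatives off `ψ₁` leaves a bidifferential operator in
`ψ₂, ψ₃` which must vanish identically, and evaluating it on powers of `x - x₀` isolates its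
coefficients (`coeff_relations_of_integral_cyclicTrilin`). Those of the jets `(2,2)`, `(3,1)`,
`(2,1)`, `(1,2)` give `Γ = ½ ∂g`, the cyclic symmetry of the transported gradient of `g`, and its
constancy along every curve. As `U` is connected, `g` is affine, and its gradient has the
symmetry of the family `g_c`. Conversely, for these operators the cyclic sum is an exact
derivative (`hasDerivAt_cyclicTrilin`).

For any metric, the contravariant Christoffel symbols equal `½ ∂g` plus a term linear in the
defect of the condition `g^{is} ∂_s g^{jk} = g^{js} ∂_s g^{ik}` (`contraChristoffel_eq`). For
`g_c` that condition consists of affine equations in `u` whose coefficients are the equations of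
the variety. Under them the connection matrices are `-½ ∂_k g g⁻¹` with `∂_k g` constant, so the
curvature is `¼ g⁻¹ (∂_k g g⁻¹ ∂_l g - ∂_l g g⁻¹ ∂_k g)`, which vanishes by `gradient_comm`.

If `g_c - λ g_d` is a flat pencil, its Christoffel symbols at a suitable `λ ≠ 0` are half its
gradient on a nonempty open set, and the symmetry of the Levi-Civita connection puts `c - λ d` in
the variety (`polar_of_flatParams`). Since the equations are homogeneous quadratic, for `c` and
`d` in the variety the line `c - λ d` lies in it if and only if the polar bilinear forms vanish
on `(c, d)`; these forms are evaluated on the pairs of cases.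
-/

open MeasureTheory Filter Topology

namespace KdVTrio

/-! ### Calculus of smooth functions on the line -/

theorem contDiff_iteratedDeriv {f : ℝ → ℝ} (hf : ContDiff ℝ ∞ f) (n : ℕ) :
    ContDiff ℝ ∞ (iteratedDeriv n f) := by
  rw [iteratedDeriv_eq_iterate]; exact hf.iterate_deriv n

theorem contDiff_deriv {f : ℝ → ℝ} (hf : ContDiff ℝ ∞ f) : ContDiff ℝ ∞ (deriv f) :=
  hf.iterate_deriv 1

theorem hasCompactSupport_iteratedDeriv {f : ℝ → ℝ} (hf : HasCompactSupport f) (n : ℕ) :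
    HasCompactSupport (iteratedDeriv n f) := by
  induction n with
  | zero => simpa using hf
  | succ n ih => rw [iteratedDeriv_succ]; exact ih.deriv

theorem iteratedDeriv_of_notMem_tsupport {f : ℝ → ℝ} {x : ℝ} (hx : x ∉ tsupport f) (n : ℕ) :
    iteratedDeriv n f x = 0 := by
  have h : f =ᶠ[𝓝 x] fun _ => 0 := notMem_tsupport_iff_eventuallyEq.mp hx
  rw [h.iteratedDeriv_eq n]; simp

theorem integrable_mul_of_hasCompactSupport {a F : ℝ → ℝ} (ha : ContDiff ℝ ∞ a)
    (hac : HasCompactSupport a) (hF : ContDiff ℝ ∞ F) : Integrable (fun x => a x * F x) :=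
  (ha.continuous.mul hF.continuous).integrable_of_hasCompactSupport hac.mul_right

/-- Repeated integration by parts against a test function. -/
theorem integral_iteratedDeriv_mul (n : ℕ) {a F : ℝ → ℝ} (ha : ContDiff ℝ ∞ a)
    (hac : HasCompactSupport a) (hF : ContDiff ℝ ∞ F) :
    ∫ x, iteratedDeriv n a x * F x = (-1) ^ n * ∫ x, a x * iteratedDeriv n F x := by
  induction n generalizing F with
  | zero => simp
  | succ n ih =>
    have han := contDiff_iteratedDeriv ha n
    have hcn := hasCompactSupport_iteratedDeriv hac n
    have han' := contDiff_iteratedDeriv ha (n + 1)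
    have hcn' := hasCompactSupport_iteratedDeriv hac (n + 1)
    have hF' := contDiff_deriv hF
    have hn : (∞ : ℕ∞ω) ≠ 0 := by simp
    have key : ∫ x, iteratedDeriv n a x * deriv F x
        = - ∫ x, iteratedDeriv (n + 1) a x * F x := by
      refine integral_mul_deriv_eq_deriv_mul_of_integrable (fun x _ => ?_) (fun x _ => ?_)
        (integrable_mul_of_hasCompactSupport han hcn hF')
        (integrable_mul_of_hasCompactSupport han' hcn' hF)
        (integrable_mul_of_hasCompactSupport han hcn hF)
      · rw [iteratedDeriv_succ]
        exact (han.differentiable hn x).hasDerivAt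
      · exact (hF.differentiable hn x).hasDerivAt
    rw [ih hF', ← iteratedDeriv_succ'] at key
    rw [pow_succ]; linarith

/-- If a linear differential operator integrates every test function to zero, then its formal
adjoint applied to `1` vanishes. -/
theorem adjoint_eq_zero_of_integral_eq_zero {F0 F1 F3 F4 : ℝ → ℝ} (h0 : ContDiff ℝ ∞ F0)
    (h1 : ContDiff ℝ ∞ F1) (h3 : ContDiff ℝ ∞ F3) (h4 : ContDiff ℝ ∞ F4)
    (H : ∀ a : ℝ → ℝ, ContDiff ℝ ∞ a → HasCompactSupport a →
      ∫ x, (a x * F0 x + deriv a x * F1 x + iteratedDeriv 3 a x * F3 x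
        + iteratedDeriv 4 a x * F4 x) = 0) (x : ℝ) :
    F0 x - deriv F1 x - iteratedDeriv 3 F3 x + iteratedDeriv 4 F4 x = 0 := by
  have s1 := contDiff_deriv h1
  have s3 := contDiff_iteratedDeriv h3 3
  have s4 := contDiff_iteratedDeriv h4 4
  set L : ℝ → ℝ := fun x => F0 x - deriv F1 x - iteratedDeriv 3 F3 x + iteratedDeriv 4 F4 x
    with hL
  have hLc : Continuous L :=
    ((h0.continuous.sub s1.continuous).sub s3.continuous).add s4.continuous
  have hae : ∀ᵐ x ∂(volume : Measure ℝ), L x = 0 := by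
    refine ae_eq_zero_of_integral_contDiff_smul_eq_zero hLc.locallyIntegrable ?_
    intro a ha hac
    have i0 := integrable_mul_of_hasCompactSupport ha hac h0
    have i1 := integrable_mul_of_hasCompactSupport ha hac s1
    have i3 := integrable_mul_of_hasCompactSupport ha hac s3
    have i4 := integrable_mul_of_hasCompactSupport ha hac s4
    have j1 := integrable_mul_of_hasCompactSupport (contDiff_deriv ha) hac.deriv h1
    have j3 := integrable_mul_of_hasCompactSupport (contDiff_iteratedDeriv ha 3)
      (hasCompactSupport_iteratedDeriv hac 3) h3
    have j4 := integrable_mul_of_hasCompactSupport (contDiff_iteratedDeriv ha 4)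
      (hasCompactSupport_iteratedDeriv hac 4) h4
    have e1 := integral_iteratedDeriv_mul 1 ha hac h1
    have e3 := integral_iteratedDeriv_mul 3 ha hac h3
    have e4 := integral_iteratedDeriv_mul 4 ha hac h4
    simp only [iteratedDeriv_one] at e1
    have e := H a ha hac
    have p1 : Integrable (fun x => a x * F0 x + deriv a x * F1 x) := i0.add j1
    have p3 : Integrable (fun x => a x * F0 x + deriv a x * F1 x + iteratedDeriv 3 a x * F3 x) :=
      p1.add j3
    have q1 : Integrable (fun x => a x * F0 x - a x * deriv F1 x) := i0.sub i1
    have q3 : Integrable (fun x => a x * F0 x - a x * deriv F1 x - a x * iteratedDeriv 3 F3 x) :=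
      q1.sub i3
    rw [integral_add p3 j4, integral_add p1 j3, integral_add i0 j1, e1, e3, e4] at e
    have : ∀ x, a x • L x = a x * F0 x - a x * deriv F1 x - a x * iteratedDeriv 3 F3 x
        + a x * iteratedDeriv 4 F4 x := fun x => by simp only [hL, smul_eq_mul]; ring
    simp only [this]
    rw [integral_add q3 i4, integral_sub q1 i3, integral_sub i0 i1]
    linarith
  have : L = fun _ => 0 := hLc.ae_eq_iff_eq volume continuous_const |>.mp hae
  exact congrFun this x

/-! ### Trilinear expressions in three scalar test functions -/

/-- The trilinear expression `a (G b''' d' + B b''' d + C b'''' d)`: a component of the Schouten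
bracket with a third-order operator. -/
noncomputable def trilin (G B C a b d : ℝ → ℝ) (x : ℝ) : ℝ :=
  a x * (G x * iteratedDeriv 3 b x * deriv d x + B x * iteratedDeriv 3 b x * d x
    + C x * iteratedDeriv 4 b x * d x)

/-- The cyclic sum of trilinear expressions. -/
noncomputable def cyclicTrilin (G₁ B₁ C₁ G₂ B₂ C₂ G₃ B₃ C₃ a b d : ℝ → ℝ) (x : ℝ) : ℝ :=
  trilin G₁ B₁ C₁ a b d x + trilin G₂ B₂ C₂ b d a x + trilin G₃ B₃ C₃ d a b x

/-- Replacing `b` and `d` by functions that agree with them near the support of `a` does not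
change the integral. -/
theorem integral_cyclicTrilin_eq_zero_of_testFunctions
    {G₁ B₁ C₁ G₂ B₂ C₂ G₃ B₃ C₃ : ℝ → ℝ}
    (H : ∀ a b d : ℝ → ℝ, ContDiff ℝ ∞ a → HasCompactSupport a → ContDiff ℝ ∞ b →
      HasCompactSupport b → ContDiff ℝ ∞ d → HasCompactSupport d →
      ∫ x, cyclicTrilin G₁ B₁ C₁ G₂ B₂ C₂ G₃ B₃ C₃ a b d x = 0)
    {a b d : ℝ → ℝ} (ha : ContDiff ℝ ∞ a) (hac : HasCompactSupport a) (hb : ContDiff ℝ ∞ b)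
    (hd : ContDiff ℝ ∞ d) : ∫ x, cyclicTrilin G₁ B₁ C₁ G₂ B₂ C₂ G₃ B₃ C₃ a b d x = 0 := by
  -- A cutoff `χ` equal to one on a ball containing the support of `a`.
  obtain ⟨R, hR0, hR⟩ := hac.isCompact.isBounded.subset_ball_lt 0 (0 : ℝ)
  let χ : ContDiffBump (0 : ℝ) := ⟨R, R + 1, hR0, by linarith⟩
  have hχ : ContDiff ℝ ∞ χ := χ.contDiff
  have hχc : HasCompactSupport χ := χ.hasCompactSupport
  have hloc : ∀ x ∈ tsupport a, ∀ f : ℝ → ℝ, (fun y => χ y * f y) =ᶠ[𝓝 x] f := by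
    intro x hx f
    filter_upwards [Metric.isOpen_ball.mem_nhds (hR hx)] with y hy
    have : χ y = 1 := χ.one_of_mem_closedBall (Metric.ball_subset_closedBall hy)
    simp [this]
  rw [← H a (fun y => χ y * b y) (fun y => χ y * d y) ha hac (hχ.mul hb) hχc.mul_right
    (hχ.mul hd) hχc.mul_right]
  congr 1
  ext x
  by_cases hx : x ∈ tsupport a
  · have eb := hloc x hx b
    have ed := hloc x hx d
    simp only [cyclicTrilin, trilin, eb.iteratedDeriv_eq, ed.iteratedDeriv_eq, eb.deriv_eq,
      ed.deriv_eq, eb.eq_of_nhds, ed.eq_of_nhds]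
  · simp [cyclicTrilin, trilin, image_eq_zero_of_notMem_tsupport hx,
      iteratedDeriv_of_notMem_tsupport hx, deriv_of_notMem_tsupport hx]

theorem iteratedDeriv_sub_pow (n m : ℕ) (x₀ : ℝ) :
    iteratedDeriv n (fun y : ℝ => (y - x₀) ^ m) x₀ = if n = m then (m.factorial : ℝ) else 0 := by
  have := congrFun (iteratedDeriv_comp_sub_const n (fun y : ℝ => y ^ m) x₀) x₀
  simp only [sub_self] at this
  rw [this, iteratedDeriv_fun_pow_zero]
  split_ifs <;> simp

theorem iteratedDeriv_mul_sub_pow {F : ℝ → ℝ} (hF : ContDiff ℝ ∞ F) (n m : ℕ) (x₀ : ℝ) :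
    iteratedDeriv n (fun y => F y * (y - x₀) ^ m) x₀
      = if m ≤ n then (n.choose m * m.factorial : ℝ) * iteratedDeriv (n - m) F x₀ else 0 := by
  have hp : ContDiff ℝ ∞ (fun y : ℝ => (y - x₀) ^ m) := by fun_prop
  have hle : ((n : ℕ∞ω)) ≤ ∞ := by exact_mod_cast le_top
  rw [iteratedDeriv_fun_mul (hF.contDiffAt.of_le hle) (hp.contDiffAt.of_le hle)]
  simp only [iteratedDeriv_sub_pow]
  split_ifs with h
  · rw [Finset.sum_eq_single (n - m)]
    · rw [if_pos (by omega), Nat.choose_symm h]; ring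
    · intro i hi hne
      rw [Finset.mem_range] at hi
      rw [if_neg (by omega), mul_zero]
    · intro hn; exact absurd (Finset.mem_range.mpr (by omega)) hn
  · refine Finset.sum_eq_zero fun i hi => ?_
    rw [if_neg (by omega), mul_zero]

/-- If the cyclic sum integrates to zero for all test functions, then the coefficients of
`b'' d''`, `b''' d'`, `b'' d'` and `b' d''` that remain after moving all derivatives off `a`
vanish. -/
theorem coeff_relations_of_integral_cyclicTrilin {G₁ B₁ C₁ G₂ B₂ C₂ G₃ B₃ C₃ : ℝ → ℝ}
    (hG₁ : ContDiff ℝ ∞ G₁) (hB₁ : ContDiff ℝ ∞ B₁) (hC₁ : ContDiff ℝ ∞ C₁)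
    (hG₂ : ContDiff ℝ ∞ G₂) (hB₂ : ContDiff ℝ ∞ B₂) (hC₂ : ContDiff ℝ ∞ C₂)
    (hG₃ : ContDiff ℝ ∞ G₃) (hB₃ : ContDiff ℝ ∞ B₃) (hC₃ : ContDiff ℝ ∞ C₃)
    (H : ∀ a b d : ℝ → ℝ, ContDiff ℝ ∞ a → HasCompactSupport a → ContDiff ℝ ∞ b →
      HasCompactSupport b → ContDiff ℝ ∞ d → HasCompactSupport d →
      ∫ x, cyclicTrilin G₁ B₁ C₁ G₂ B₂ C₂ G₃ B₃ C₃ a b d x = 0) (x₀ : ℝ) :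
    C₃ x₀ = G₃ x₀ / 2 ∧ G₁ x₀ = G₃ x₀ ∧ deriv G₃ x₀ = 0 := by
  have key : ∀ b d : ℝ → ℝ, ContDiff ℝ ∞ b → ContDiff ℝ ∞ d →
      (G₁ x₀ * iteratedDeriv 3 b x₀ * deriv d x₀ + B₁ x₀ * iteratedDeriv 3 b x₀ * d x₀
        + C₁ x₀ * iteratedDeriv 4 b x₀ * d x₀ + B₂ x₀ * iteratedDeriv 3 d x₀ * b x₀
        + C₂ x₀ * iteratedDeriv 4 d x₀ * b x₀)
      - deriv (fun x => G₂ x * iteratedDeriv 3 d x * b x) x₀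
      - iteratedDeriv 3 (fun x => G₃ x * (d x * deriv b x) + B₃ x * (d x * b x)) x₀
      + iteratedDeriv 4 (fun x => C₃ x * (d x * b x)) x₀ = 0 := by
    intro b d hb hd
    have hb' := contDiff_deriv hb
    have hd' := contDiff_deriv hd
    have hb3 := contDiff_iteratedDeriv hb 3
    have hd3 := contDiff_iteratedDeriv hd 3
    have hb4 := contDiff_iteratedDeriv hb 4
    have hd4 := contDiff_iteratedDeriv hd 4
    refine adjoint_eq_zero_of_integral_eq_zero
      (F0 := fun x₀ => G₁ x₀ * iteratedDeriv 3 b x₀ * deriv d x₀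
        + B₁ x₀ * iteratedDeriv 3 b x₀ * d x₀
        + C₁ x₀ * iteratedDeriv 4 b x₀ * d x₀ + B₂ x₀ * iteratedDeriv 3 d x₀ * b x₀
        + C₂ x₀ * iteratedDeriv 4 d x₀ * b x₀) (by fun_prop) (by fun_prop) (by fun_prop)
        (by fun_prop) ?_ x₀
    intro a ha hac
    rw [← integral_cyclicTrilin_eq_zero_of_testFunctions H ha hac hb hd]
    congr 1
    ext x
    simp only [cyclicTrilin, trilin]
    ring
  have hpow : ∀ m : ℕ, ContDiff ℝ ∞ (fun y : ℝ => (y - x₀) ^ m) := fun m => by fun_prop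
  have hle : ((3 : ℕ) : ℕ∞ω) ≤ ∞ := WithTop.coe_le_coe.mpr le_top
  -- Evaluation on `b = (x - x₀) ^ (m + 1)`, `d = (x - x₀) ^ (n + 1)` isolates one jet. For `n ≤ 1`
  -- also `d''' = 0`, so that only `G₁` and the coefficients with index `3` contribute.
  have eval : ∀ m n : ℕ, n ≤ 1 →
      ((G₁ x₀ * iteratedDeriv 3 (fun y : ℝ => (y - x₀) ^ (m + 1)) x₀
          * iteratedDeriv 1 (fun y : ℝ => (y - x₀) ^ (n + 1)) x₀))
      - (((m + 1 : ℕ) : ℝ) * iteratedDeriv 3 (fun x => G₃ x * (x - x₀) ^ (m + n + 1)) x₀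
        + iteratedDeriv 3 (fun x => B₃ x * (x - x₀) ^ (m + n + 2)) x₀)
      + iteratedDeriv 4 (fun x => C₃ x * (x - x₀) ^ (m + n + 2)) x₀ = 0 := by
    intro m n hn
    have h := key _ _ (hpow (m + 1)) (hpow (n + 1))
    have hd3 : iteratedDeriv 3 (fun y : ℝ => (y - x₀) ^ (n + 1)) = fun _ => 0 := by
      ext x
      have := congrFun (iteratedDeriv_comp_sub_const 3 (fun y : ℝ => y ^ (n + 1)) x₀) x
      rw [this, iteratedDeriv_pow, Nat.descFactorial_of_lt (by omega)]
      simp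
    have hderiv : ∀ x, deriv (fun y : ℝ => (y - x₀) ^ (m + 1)) x
        = ((m + 1 : ℕ) : ℝ) * (x - x₀) ^ m := by
      intro x
      simp
    have e1 : (fun x => G₃ x * ((x - x₀) ^ (n + 1) * deriv (fun y : ℝ => (y - x₀) ^ (m + 1)) x)
        + B₃ x * ((x - x₀) ^ (n + 1) * (x - x₀) ^ (m + 1)))
        = fun x => ((m + 1 : ℕ) : ℝ) * (G₃ x * (x - x₀) ^ (m + n + 1))
          + B₃ x * (x - x₀) ^ (m + n + 2) := by
      ext x; rw [hderiv]; ring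
    have e2 : (fun x => C₃ x * ((x - x₀) ^ (n + 1) * (x - x₀) ^ (m + 1)))
        = fun x => C₃ x * (x - x₀) ^ (m + n + 2) := by
      ext x; ring
    have hGc : ContDiff ℝ ∞ (fun x => G₃ x * (x - x₀) ^ (m + n + 1)) := hG₃.mul (hpow _)
    have hBc : ContDiff ℝ ∞ (fun x => B₃ x * (x - x₀) ^ (m + n + 2)) := hB₃.mul (hpow _)
    rw [e1, e2, hd3, iteratedDeriv_fun_add ((contDiff_const.mul hGc).contDiffAt.of_le hle)
      (hBc.contDiffAt.of_le hle), iteratedDeriv_const_mul_field] at h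
    simp only [sub_self, zero_pow (Nat.succ_ne_zero _), mul_zero, zero_mul, add_zero,
      deriv_const, sub_zero] at h
    rw [iteratedDeriv_one]
    exact h
  have h22 := eval 1 1 le_rfl
  have h31 := eval 2 0 (by norm_num)
  have h21 := eval 1 0 (by norm_num)
  have h12 := eval 0 1 le_rfl
  simp only [iteratedDeriv_mul_sub_pow hG₃, iteratedDeriv_mul_sub_pow hB₃,
    iteratedDeriv_mul_sub_pow hC₃, iteratedDeriv_sub_pow] at h22 h31 h21 h12
  norm_num [Nat.choose, Nat.factorial] at h22 h31 h21 h12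
  refine ⟨by linarith, by linarith, by linarith⟩

/-- For `G = 1`, `B = 0` and `C = 1 / 2` in all three terms, the cyclic sum is an exact
derivative. As a polynomial in the symbols `ξ, η, ζ` of `∂` acting on `a, b, d` it is `(ξ + η + ζ)
(ξ³ + η³ + ζ³ + ξ²η - ξη² + η²ζ - ηζ² + ζ²ξ - ζξ²) / 2`. -/
theorem hasDerivAt_cyclicTrilin {a b d : ℝ → ℝ} (ha : ContDiff ℝ ∞ a) (hb : ContDiff ℝ ∞ b)
    (hd : ContDiff ℝ ∞ d) (x : ℝ) :
    HasDerivAt (fun x => 1 / 2 * (iteratedDeriv 3 a x * (b x * d x)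
        + iteratedDeriv 3 b x * (a x * d x) + iteratedDeriv 3 d x * (a x * b x)
        + iteratedDeriv 2 a x * (deriv b x * d x - b x * deriv d x)
        + iteratedDeriv 2 b x * (deriv d x * a x - d x * deriv a x)
        + iteratedDeriv 2 d x * (deriv a x * b x - a x * deriv b x)))
      (cyclicTrilin (fun _ => 1) (fun _ => 0) (fun _ => 1 / 2) (fun _ => 1) (fun _ => 0)
        (fun _ => 1 / 2) (fun _ => 1) (fun _ => 0) (fun _ => 1 / 2) a b d x) x := by
  have hn : (∞ : ℕ∞ω) ≠ 0 := by simp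
  have D : ∀ {f : ℝ → ℝ}, ContDiff ℝ ∞ f → ∀ n,
      HasDerivAt (iteratedDeriv n f) (iteratedDeriv (n + 1) f x) x := fun hf n => by
    rw [iteratedDeriv_succ]
    exact ((contDiff_iteratedDeriv hf n).differentiable hn x).hasDerivAt
  have a0 := D ha 0
  have b0 := D hb 0
  have d0 := D hd 0
  have a1 := D ha 1
  have b1 := D hb 1
  have d1 := D hd 1
  simp only [zero_add, iteratedDeriv_zero] at a0 b0 d0
  simp only [iteratedDeriv_one, Nat.reduceAdd] at a0 b0 d0 a1 b1 d1
  have := (((((((D ha 3).mul (b0.mul d0)).add ((D hb 3).mul (a0.mul d0))).add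
    ((D hd 3).mul (a0.mul b0))).add ((D ha 2).mul ((b1.mul d0).sub (b0.mul d1)))).add
    ((D hb 2).mul ((d1.mul a0).sub (d0.mul a1)))).add
    ((D hd 2).mul ((a1.mul b0).sub (a0.mul b1)))).const_mul (1 / 2 : ℝ)
  refine this.congr_deriv ?_
  simp only [cyclicTrilin, trilin, Pi.mul_apply, Pi.sub_apply, Nat.reduceAdd]
  ring

theorem integral_cyclicTrilin_const {a b d : ℝ → ℝ} (ha : ContDiff ℝ ∞ a)
    (hac : HasCompactSupport a) (hb : ContDiff ℝ ∞ b) (hd : ContDiff ℝ ∞ d) :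
    Integrable (cyclicTrilin (fun _ => 1) (fun _ => 0) (fun _ => 1 / 2) (fun _ => 1)
      (fun _ => 0) (fun _ => 1 / 2) (fun _ => 1) (fun _ => 0) (fun _ => 1 / 2) a b d) ∧
    ∫ x, cyclicTrilin (fun _ => 1) (fun _ => 0) (fun _ => 1 / 2) (fun _ => 1) (fun _ => 0)
      (fun _ => 1 / 2) (fun _ => 1) (fun _ => 0) (fun _ => 1 / 2) a b d x = 0 := by
  have ha' := contDiff_deriv ha
  have hb' := contDiff_deriv hb
  have hd' := contDiff_deriv hd
  have ha2 := contDiff_iteratedDeriv ha 2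
  have hb2 := contDiff_iteratedDeriv hb 2
  have hd2 := contDiff_iteratedDeriv hd 2
  have ha3 := contDiff_iteratedDeriv ha 3
  have hb3 := contDiff_iteratedDeriv hb 3
  have hd3 := contDiff_iteratedDeriv hd 3
  have ha4 := contDiff_iteratedDeriv ha 4
  have hb4 := contDiff_iteratedDeriv hb 4
  have hd4 := contDiff_iteratedDeriv hd 4
  have hK : ∀ {F : ℝ → ℝ}, Continuous F → (∀ x ∉ tsupport a, F x = 0) → Integrable F :=
    fun hF h0 => hF.integrable_of_hasCompactSupport (HasCompactSupport.intro hac.isCompact h0)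
  have hint : Integrable (cyclicTrilin (fun _ => 1) (fun _ => 0) (fun _ => 1 / 2) (fun _ => 1)
      (fun _ => 0) (fun _ => 1 / 2) (fun _ => 1) (fun _ => 0) (fun _ => 1 / 2) a b d) := by
    refine hK ?_ fun x hx => ?_
    · have : ContDiff ℝ ∞ (cyclicTrilin (fun _ => 1) (fun _ => 0) (fun _ => 1 / 2) (fun _ => 1)
          (fun _ => 0) (fun _ => 1 / 2) (fun _ => 1) (fun _ => 0) (fun _ => 1 / 2) a b d) := by
        unfold cyclicTrilin trilin; fun_prop
      exact this.continuous
    · simp [cyclicTrilin, trilin, image_eq_zero_of_notMem_tsupport hx,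
        iteratedDeriv_of_notMem_tsupport hx, deriv_of_notMem_tsupport hx]
  refine ⟨hint, integral_eq_zero_of_hasDerivAt_of_integrable
    (hasDerivAt_cyclicTrilin ha hb hd) hint (hK ?_ fun x hx => ?_)⟩
  · refine ContDiff.continuous (𝕜 := ℝ) (n := ∞) ?_
    fun_prop
  · simp [image_eq_zero_of_notMem_tsupport hx, iteratedDeriv_of_notMem_tsupport hx,
      deriv_of_notMem_tsupport hx]

/-! ### The Schouten bracket of a hydrodynamic operator with the third-order operator -/

theorem fderiv_apply_eq_sum_pd (f : Coord → ℝ) (p w : Coord) :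
    fderiv ℝ f p w = ∑ l, w l * pd l f p := by
  have h : w = ∑ l, w l • (Pi.single l 1 : Coord) := by
    ext m; simp [Finset.sum_apply, Pi.single_apply]
  conv_lhs => rw [h]
  simp [pd]

theorem hasDerivAt_comp_add_smul {f : Coord → ℝ} {p : Coord} (hf : DifferentiableAt ℝ f p)
    (w : Coord) : HasDerivAt (fun ε : ℝ => f (p + ε • w)) (∑ l, w l * pd l f p) 0 := by
  rw [← fderiv_apply_eq_sum_pd]
  have h1 : HasDerivAt (fun ε : ℝ => p + ε • w) w 0 := by
    simpa using ((hasDerivAt_id (0 : ℝ)).smul_const w).const_add p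
  have h2 : HasFDerivAt f (fderiv ℝ f p) (p + (0 : ℝ) • w) := by simpa using hf.hasFDerivAt
  exact h2.comp_hasDerivAt (0 : ℝ) h1

theorem variation_hydroOp {g : ContraTensor} {Γ : ContraSymbols} {u w ψ : Fields} {x : ℝ}
    (hg : ∀ i j, DifferentiableAt ℝ (fun v => g v i j) (u x))
    (hΓ : ∀ i j k, DifferentiableAt ℝ (fun v => Γ v i j k) (u x))
    (hu : ∀ k, DifferentiableAt ℝ (fun y => u y k) x)
    (hw : ∀ k, DifferentiableAt ℝ (fun y => w y k) x) (i : Fin 2) :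
    variation (hydroOp g Γ) u w ψ x i = ∑ j,
      ((∑ l, w x l * pd l (fun v => g v i j) (u x)) * deriv (fun y => ψ y j) x
        + (∑ k, ((∑ l, w x l * pd l (fun v => Γ v i j k) (u x)) * deriv (fun y => u y k) x
          + Γ (u x) i j k * deriv (fun y => w y k) x)) * ψ x j) := by
  refine HasDerivAt.deriv ?_
  refine HasDerivAt.fun_sum fun j _ => ?_
  refine HasDerivAt.add ((hasDerivAt_comp_add_smul (hg i j) (w x)).mul_const _) ?_
  refine HasDerivAt.mul_const (HasDerivAt.fun_sum fun k _ => ?_) _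
  have hline : HasDerivAt (fun ε : ℝ => deriv (fun y => (u + ε • w) y k) x)
      (deriv (fun y => w y k) x) 0 := by
    have : (fun ε : ℝ => deriv (fun y => (u + ε • w) y k) x)
        = fun ε => deriv (fun y => u y k) x + ε * deriv (fun y => w y k) x := by
      ext ε
      exact ((hu k).hasDerivAt.add ((hw k).hasDerivAt.const_mul ε)).deriv
    rw [this]
    simpa using ((hasDerivAt_id (0 : ℝ)).mul_const (deriv (fun y => w y k) x)).const_add
      (deriv (fun y => u y k) x)
  simpa using! (hasDerivAt_comp_add_smul (hΓ i j k) (w x)).fun_mul hline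

theorem variation_R3 (u w ψ : Fields) (x : ℝ) (i : Fin 2) : variation R3 u w ψ x i = 0 := by
  simp [variation, R3]

theorem R3_apply (u ψ : Fields) (x : ℝ) (k : Fin 2) :
    R3 u ψ x k = iteratedDeriv 3 (fun y => ψ y k.rev) x := by
  fin_cases k <;> simp [R3, Fin.sum_univ_two]

/-- The coefficient `∂_{σ k} g^{ij}` of `ψ₁^i ψ₂^k''' ψ₃^j'` in the bracket, `σ` exchanging the
two components. -/
noncomputable def coeffG (g : ContraTensor) (u : Fields) (i j k : Fin 2) (x : ℝ) : ℝ :=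
  pd k.rev (fun v => g v i j) (u x)

/-- The coefficient `∂_{σ k} Γ^{ij}_m u^m_x` of `ψ₁^i ψ₂^k''' ψ₃^j` in the bracket. -/
noncomputable def coeffB (Γ : ContraSymbols) (u : Fields) (i j k : Fin 2) (x : ℝ) : ℝ :=
  ∑ m, pd k.rev (fun v => Γ v i j m) (u x) * deriv (fun y => u y m) x

/-- The coefficient `Γ^{ij}_{σ k}` of `ψ₁^i ψ₂^k'''' ψ₃^j` in the bracket. -/
def coeffC (Γ : ContraSymbols) (u : Fields) (i j k : Fin 2) (x : ℝ) : ℝ :=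
  Γ (u x) i j k.rev

theorem contDiff_component {ψ : Fields} (hψ : ContDiff ℝ ∞ ψ) (k : Fin 2) :
    ContDiff ℝ ∞ (fun y => ψ y k) := contDiff_pi.mp hψ k

section Smooth

variable {U : Set Coord} {g : ContraTensor} {Γ : ContraSymbols} {u : Fields}

theorem contDiffOn_pd (hU : IsOpen U) {f : Coord → ℝ} (hf : ContDiffOn ℝ ∞ f U) (k : Fin 2) :
    ContDiffOn ℝ ∞ (pd k f) U :=
  (hf.fderiv_of_isOpen hU (by simp)).clm_apply contDiffOn_const

theorem contDiff_comp_field {f : Coord → ℝ} (hf : ContDiffOn ℝ ∞ f U) (hu : ContDiff ℝ ∞ u)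
    (huU : ∀ x, u x ∈ U) : ContDiff ℝ ∞ (fun x => f (u x)) := by
  rw [← contDiffOn_univ]
  exact hf.comp hu.contDiffOn fun x _ => huU x

theorem contDiff_coeffG (hU : IsOpen U) (hg : ∀ i j, ContDiffOn ℝ ∞ (fun u => g u i j) U)
    (hu : ContDiff ℝ ∞ u) (huU : ∀ x, u x ∈ U) (i j k : Fin 2) :
    ContDiff ℝ ∞ (coeffG g u i j k) :=
  contDiff_comp_field (contDiffOn_pd hU (hg i j) _) hu huU

theorem contDiff_coeffB (hU : IsOpen U) (hΓ : ∀ i j k, ContDiffOn ℝ ∞ (fun u => Γ u i j k) U)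
    (hu : ContDiff ℝ ∞ u) (huU : ∀ x, u x ∈ U) (i j k : Fin 2) :
    ContDiff ℝ ∞ (coeffB Γ u i j k) :=
  ContDiff.sum fun m _ => (contDiff_comp_field (contDiffOn_pd hU (hΓ i j m) _) hu huU).mul
    (contDiff_deriv (contDiff_component hu m))

theorem contDiff_coeffC (hΓ : ∀ i j k, ContDiffOn ℝ ∞ (fun u => Γ u i j k) U)
    (hu : ContDiff ℝ ∞ u) (huU : ∀ x, u x ∈ U) (i j k : Fin 2) :
    ContDiff ℝ ∞ (coeffC Γ u i j k) :=
  contDiff_comp_field (hΓ i j _) hu huU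

theorem bracketTerm_hydroOp_R3 (hU : IsOpen U)
    (hg : ∀ i j, ContDiffOn ℝ ∞ (fun u => g u i j) U)
    (hΓ : ∀ i j k, ContDiffOn ℝ ∞ (fun u => Γ u i j k) U)
    (hu : ContDiff ℝ ∞ u) (huU : ∀ x, u x ∈ U) (ψ₁ : Fields) {ψ₂ : Fields}
    (hψ₂ : ContDiff ℝ ∞ ψ₂) (ψ₃ : Fields) (x : ℝ) :
    bracketTerm (hydroOp g Γ) R3 u ψ₁ ψ₂ ψ₃ x = ∑ i, ∑ j, ∑ k,
      trilin (coeffG g u i j k) (coeffB Γ u i j k) (coeffC Γ u i j k)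
        (fun y => ψ₁ y i) (fun y => ψ₂ y k) (fun y => ψ₃ y j) x := by
  have hn : (∞ : ℕ∞ω) ≠ 0 := by simp
  have hat : ∀ {f : Coord → ℝ}, ContDiffOn ℝ ∞ f U → DifferentiableAt ℝ f (u x) := fun hf =>
    (hf.contDiffAt (hU.mem_nhds (huU x))).differentiableAt hn
  have hR : ∀ k, (fun y => R3 u ψ₂ y k) = iteratedDeriv 3 (fun y => ψ₂ y k.rev) := fun k =>
    funext fun y => R3_apply u ψ₂ y k
  have hw : ∀ k, DifferentiableAt ℝ (fun y => R3 u ψ₂ y k) x := fun k => by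
    rw [hR]
    exact (contDiff_iteratedDeriv (contDiff_component hψ₂ _) 3).differentiable hn x
  simp only [bracketTerm, variation_R3, add_zero]
  refine Finset.sum_congr rfl fun i _ => ?_
  rw [variation_hydroOp (fun i j => hat (hg i j)) (fun i j k => hat (hΓ i j k))
    (fun k => (contDiff_component hu k).differentiable hn x) hw, Finset.mul_sum]
  refine Finset.sum_congr rfl fun j _ => ?_
  simp only [← iteratedDeriv_succ, R3_apply, trilin, coeffG, coeffB, coeffC,
    Fin.sum_univ_two, Nat.reduceAdd]
  simp only [show (0 : Fin 2).rev = 1 from rfl, show (1 : Fin 2).rev = 0 from rfl]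
  ring

/-- The cyclic sum in the bracket, decomposed along the components of the three arguments. -/
theorem bracketTerm_cyclic (hU : IsOpen U)
    (hg : ∀ i j, ContDiffOn ℝ ∞ (fun u => g u i j) U)
    (hΓ : ∀ i j k, ContDiffOn ℝ ∞ (fun u => Γ u i j k) U)
    (hu : ContDiff ℝ ∞ u) (huU : ∀ x, u x ∈ U) {ψ₁ ψ₂ ψ₃ : Fields} (hψ₁ : ContDiff ℝ ∞ ψ₁)
    (hψ₂ : ContDiff ℝ ∞ ψ₂) (hψ₃ : ContDiff ℝ ∞ ψ₃) (x : ℝ) :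
    bracketTerm (hydroOp g Γ) R3 u ψ₁ ψ₂ ψ₃ x + bracketTerm (hydroOp g Γ) R3 u ψ₂ ψ₃ ψ₁ x
        + bracketTerm (hydroOp g Γ) R3 u ψ₃ ψ₁ ψ₂ x
      = ∑ p, ∑ q, ∑ r, cyclicTrilin
        (coeffG g u p r q) (coeffB Γ u p r q) (coeffC Γ u p r q)
        (coeffG g u q p r) (coeffB Γ u q p r) (coeffC Γ u q p r)
        (coeffG g u r q p) (coeffB Γ u r q p) (coeffC Γ u r q p)
        (fun y => ψ₁ y p) (fun y => ψ₂ y q) (fun y => ψ₃ y r) x := by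
  rw [bracketTerm_hydroOp_R3 hU hg hΓ hu huU ψ₁ hψ₂ ψ₃,
    bracketTerm_hydroOp_R3 hU hg hΓ hu huU ψ₂ hψ₃ ψ₁,
    bracketTerm_hydroOp_R3 hU hg hΓ hu huU ψ₃ hψ₁ ψ₂]
  simp only [cyclicTrilin, Fin.sum_univ_two]
  ring

/-- Compatibility, tested on fields with a single nonzero component. -/
theorem relations_of_compatible (hU : IsOpen U)
    (hg : ∀ i j, ContDiffOn ℝ ∞ (fun u => g u i j) U)
    (hΓ : ∀ i j k, ContDiffOn ℝ ∞ (fun u => Γ u i j k) U)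
    (hc : Compatible U (hydroOp g Γ) R3)
    (hu : ContDiff ℝ ∞ u) (huU : ∀ x, u x ∈ U) (p q r : Fin 2) (x₀ : ℝ) :
    coeffC Γ u r q p x₀ = coeffG g u r q p x₀ / 2 ∧
      coeffG g u p r q x₀ = coeffG g u r q p x₀ ∧ deriv (coeffG g u r q p) x₀ = 0 := by
  have sG := contDiff_coeffG hU hg hu huU
  have sB := contDiff_coeffB hU hΓ hu huU
  have sC := contDiff_coeffC hΓ hu huU
  refine coeff_relations_of_integral_cyclicTrilin (sG p r q) (sB p r q) (sC p r q)
    (sG q p r) (sB q p r) (sC q p r) (sG r q p) (sB r q p) (sC r q p) ?_ x₀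
  intro a b d ha hac hb hbc hd hdc
  have smooth : ∀ (s : Fin 2) {f : ℝ → ℝ}, ContDiff ℝ ∞ f →
      ContDiff ℝ ∞ (fun x => Pi.single s (f x) : Fields) := by
    intro s f hf
    refine contDiff_pi.mpr fun i => ?_
    by_cases h : i = s
    · subst h; simpa using hf
    · simpa [h] using contDiff_const
  have supp : ∀ (s : Fin 2) {f : ℝ → ℝ}, HasCompactSupport f →
      HasCompactSupport (fun x => Pi.single s (f x) : Fields) := fun s f hf =>
    hf.comp_left (g := fun t : ℝ => (Pi.single s t : Coord)) (Pi.single_zero s)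
  have h := hc u hu huU _ _ _ (smooth p ha) (supp p hac) (smooth q hb) (supp q hbc)
    (smooth r hd) (supp r hdc)
  rw [← h]
  congr 1
  ext x
  rw [bracketTerm_cyclic hU hg hΓ hu huU (smooth p ha) (smooth q hb) (smooth r hd)]
  rw [Finset.sum_eq_single p, Finset.sum_eq_single q, Finset.sum_eq_single r]
  · simp
  · intro s _ hs; simp [hs, cyclicTrilin, trilin]
  · simp
  · intro s _ hs; simp [hs, cyclicTrilin, trilin]
  · simp
  · intro s _ hs; simp [hs, cyclicTrilin, trilin]
  · simp

/-- Through every point of an open set passes, with any prescribed direction, a smooth curve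
that stays in the set. -/
theorem exists_curve (hU : IsOpen U) {p : Coord} (hp : p ∈ U) (v : Coord) :
    ∃ δ : ℝ, δ ≠ 0 ∧ ∃ u : Fields, ContDiff ℝ ∞ u ∧ (∀ x, u x ∈ U) ∧ u 0 = p ∧
      HasDerivAt u (δ • v) 0 := by
  obtain ⟨ε, hε, hball⟩ := Metric.isOpen_iff.mp hU p hp
  have hpos : 0 < ‖v‖ + 1 := by positivity
  refine ⟨ε / (2 * (‖v‖ + 1)), by positivity,
    fun x => p + (Real.sin x * (ε / (2 * (‖v‖ + 1)))) • v, ?_, fun x => hball ?_, by simp, ?_⟩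
  · fun_prop
  · rw [Metric.mem_ball, dist_eq_norm, add_sub_cancel_left, norm_smul, norm_mul,
      Real.norm_eq_abs, Real.norm_eq_abs, abs_of_pos (show 0 < ε / (2 * (‖v‖ + 1)) by positivity)]
    have h1 := Real.abs_sin_le_one x
    have h2 : ε / (2 * (‖v‖ + 1)) * ‖v‖ < ε := by
      rw [div_mul_eq_mul_div, div_lt_iff₀ (by positivity)]
      nlinarith [norm_nonneg v]
    calc |Real.sin x| * (ε / (2 * (‖v‖ + 1))) * ‖v‖
        = |Real.sin x| * (ε / (2 * (‖v‖ + 1)) * ‖v‖) := by ring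
      _ ≤ 1 * (ε / (2 * (‖v‖ + 1)) * ‖v‖) := by gcongr
      _ < ε := by linarith
  · simpa using (((Real.hasDerivAt_sin 0).mul_const
      (ε / (2 * (‖v‖ + 1)))).smul_const v).const_add p

/-- Compatibility makes `Γ` half the gradient of `g`, makes the gradient of `g`, with index
transported by the matrix of the third-order operator, cyclically symmetric, and makes it
constant. -/
theorem pointwise_relations_of_compatible (hU : IsOpen U)
    (hg : ∀ i j, ContDiffOn ℝ ∞ (fun u => g u i j) U)
    (hΓ : ∀ i j k, ContDiffOn ℝ ∞ (fun u => Γ u i j k) U)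
    (hc : Compatible U (hydroOp g Γ) R3) {p : Coord} (hp : p ∈ U) (i j k : Fin 2) :
    Γ p i j k = 1 / 2 * pd k (fun v => g v i j) p ∧
      pd k.rev (fun v => g v i j) p = pd j.rev (fun v => g v k i) p ∧
      fderiv ℝ (pd k (fun v => g v i j)) p = 0 := by
  refine ⟨?_, ?_, ?_⟩
  · obtain ⟨δ, -, u, hu, huU, h0, -⟩ := exists_curve hU hp 0
    have h := (relations_of_compatible hU hg hΓ hc hu huU k.rev j i 0).1
    simp only [coeffC, coeffG, h0, Fin.rev_rev] at h
    rw [h]; ring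
  · obtain ⟨δ, -, u, hu, huU, h0, -⟩ := exists_curve hU hp 0
    have h := (relations_of_compatible hU hg hΓ hc hu huU k j i 0).2.1
    simp only [coeffG, h0] at h
    exact h.symm
  · ext v
    obtain ⟨δ, hδ, u, hu, huU, h0, hv⟩ := exists_curve hU hp v
    have h := (relations_of_compatible hU hg hΓ hc hu huU k.rev j i 0).2.2
    have hd : DifferentiableAt ℝ (pd k (fun v => g v i j)) (u 0) :=
      ((contDiffOn_pd hU (hg i j) k).contDiffAt (hU.mem_nhds (huU 0))).differentiableAt (by simp)
    have h' := (hd.hasFDerivAt.comp_hasDerivAt (0 : ℝ) hv).deriv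
    have e : coeffG g u i j k.rev = pd k (fun v => g v i j) ∘ u := by
      ext x; simp [coeffG]
    rw [e, h', map_smul, h0, smul_eq_mul, mul_eq_zero] at h
    simpa using h.resolve_left hδ

/-! ### The operators compatible with the third-order operator -/

theorem pd_affine (k : Fin 2) (α β γ : ℝ) (p : Coord) :
    pd k (fun v => α * v 0 + β * v 1 + γ) p = if k = 0 then α else β := by
  have h : HasFDerivAt (fun v : Coord => α * v 0 + β * v 1 + γ)
      (α • ContinuousLinearMap.proj (R := ℝ) (φ := fun _ : Fin 2 => ℝ) 0
        + β • ContinuousLinearMap.proj (R := ℝ) (φ := fun _ : Fin 2 => ℝ) 1) p :=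
    ((((ContinuousLinearMap.proj (R := ℝ) (φ := fun _ : Fin 2 => ℝ) 0).hasFDerivAt).const_mul
      α).add (((ContinuousLinearMap.proj (R := ℝ) (φ := fun _ : Fin 2 => ℝ)
        1).hasFDerivAt).const_mul β)).add_const γ
  rw [pd, h.fderiv]
  fin_cases k <;> simp

theorem pd_congr_of_eqOn (hU : IsOpen U) {f h : Coord → ℝ} (hfh : ∀ v ∈ U, f v = h v) {p : Coord}
    (hp : p ∈ U) (k : Fin 2) : pd k f p = pd k h p := by
  have : f =ᶠ[𝓝 p] h := by filter_upwards [hU.mem_nhds hp] with v hv using hfh v hv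
  rw [pd, pd, this.fderiv_eq]

/-- On a connected open set a function with constant partial derivatives is affine. -/
theorem eq_affine_of_pd_eq (hU : IsOpen U) (hUc : IsPreconnected U) {f : Coord → ℝ}
    (hf : DifferentiableOn ℝ f U) {α β : ℝ} (h0 : ∀ p ∈ U, pd 0 f p = α)
    (h1 : ∀ p ∈ U, pd 1 f p = β) : ∃ γ, ∀ p ∈ U, f p = α * p 0 + β * p 1 + γ := by
  have hd : Differentiable ℝ (fun v : Coord => α * v 0 + β * v 1 + 0) := by fun_prop
  obtain ⟨γ, hγ⟩ := hU.exists_eq_add_of_fderiv_eq hUc hf hd.differentiableOn (fun p hp => by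
    ext w
    rw [fderiv_apply_eq_sum_pd, fderiv_apply_eq_sum_pd]
    simp only [Fin.sum_univ_two, h0 p hp, h1 p hp, pd_affine]
    simp)
  exact ⟨γ, fun p hp => by simpa using hγ hp⟩

/-- The constant matrix of the partial derivatives `∂_k g^{ij}` of `c.metric`. -/
def Params.gradient (c : Params) (k : Fin 2) : Matrix (Fin 2) (Fin 2) ℝ :=
  ![!![c.c1, c.c4; c.c4, c.c6], !![c.c2, c.c1; c.c1, c.c4]] k

theorem pd_metric (c : Params) (k i j : Fin 2) (p : Coord) :
    pd k (fun v => c.metric v i j) p = c.gradient k i j := by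
  fin_cases i <;> fin_cases j <;> simp only [Params.metric, Fin.zero_eta, Fin.mk_one,
    Matrix.of_apply, Matrix.cons_val_zero, Matrix.cons_val_one, Matrix.cons_val', pd_affine,
    Matrix.cons_val_fin_one] <;> fin_cases k <;> simp [Params.gradient]

/-- The gradient of `g` is constant on the connected set `U`, so `g` is affine; the cyclic
symmetry of the gradient identifies the coefficients that `c.metric` shares between its entries.
-/
theorem exists_params_of_compatible (hU : IsOpen U) (hUc : IsConnected U)
    (hg : ∀ i j, ContDiffOn ℝ ∞ (fun u => g u i j) U)
    (hΓ : ∀ i j k, ContDiffOn ℝ ∞ (fun u => Γ u i j k) U)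
    (hs : ∀ u ∈ U, (g u).IsSymm) (hc : Compatible U (hydroOp g Γ) R3) :
    (∃ c : Params, ∀ u ∈ U, g u = c.metric u) ∧
      ∀ u ∈ U, ∀ i j k, Γ u i j k = 1 / 2 * pd k (fun v => g v i j) u := by
  have rel := fun (p : Coord) (hp : p ∈ U) => pointwise_relations_of_compatible hU hg hΓ hc hp
  refine ⟨?_, fun u hu i j k => (rel u hu i j k).1⟩
  obtain ⟨p₀, hp₀⟩ := hUc.nonempty
  have hn : (∞ : ℕ∞ω) ≠ 0 := by simp
  have const : ∀ i j k, ∀ p ∈ U, pd k (fun v => g v i j) p = pd k (fun v => g v i j) p₀ :=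
    fun i j k p hp => hU.is_const_of_fderiv_eq_zero hUc.isPreconnected
      ((contDiffOn_pd hU (hg i j) k).differentiableOn hn) (fun q hq => (rel q hq i j k).2.2) hp hp₀
  have aff := fun i j => eq_affine_of_pd_eq hU hUc.isPreconnected ((hg i j).differentiableOn hn)
    (const i j 0) (const i j 1)
  have sym : ∀ k, pd k (fun v => g v 1 0) p₀ = pd k (fun v => g v 0 1) p₀ := fun k =>
    pd_congr_of_eqOn hU (fun v hv => (hs v hv).apply 0 1) hp₀ k
  have e1 := (rel p₀ hp₀ 0 0 1).2.1
  have e2 := (rel p₀ hp₀ 1 1 0).2.1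
  simp only [show (0 : Fin 2).rev = 1 from rfl, show (1 : Fin 2).rev = 0 from rfl] at e1 e2
  rw [sym] at e1
  obtain ⟨γ00, h00⟩ := aff 0 0
  obtain ⟨γ01, h01⟩ := aff 0 1
  obtain ⟨γ11, h11⟩ := aff 1 1
  refine ⟨⟨pd 0 (fun v => g v 0 0) p₀, pd 1 (fun v => g v 0 0) p₀, γ00,
    pd 0 (fun v => g v 0 1) p₀, γ01, pd 0 (fun v => g v 1 1) p₀, γ11⟩, fun u hu => ?_⟩
  ext i j
  fin_cases i <;> fin_cases j
  · simpa [Params.metric] using h00 u hu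
  · simpa [Params.metric, e1] using h01 u hu
  · simpa [Params.metric, e1] using ((hs u hu).apply 0 1).trans (h01 u hu)
  · simpa [Params.metric, e2] using h11 u hu

/-- For `g = g_c` and `Γ = ½ ∂g` the cyclic sum has constant, totally symmetric coefficients, so it
is an exact derivative. -/
theorem compatible_of_params (hU : IsOpen U)
    (hg : ∀ i j, ContDiffOn ℝ ∞ (fun u => g u i j) U)
    (hΓ : ∀ i j k, ContDiffOn ℝ ∞ (fun u => Γ u i j k) U) {c : Params}
    (hgc : ∀ u ∈ U, g u = c.metric u)
    (hΓg : ∀ u ∈ U, ∀ i j k, Γ u i j k = 1 / 2 * pd k (fun v => g v i j) u) :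
    Compatible U (hydroOp g Γ) R3 := by
  intro u hu huU ψ₁ ψ₂ ψ₃ hψ₁ hc₁ hψ₂ hc₂ hψ₃ hc₃
  set K : Fin 2 → Fin 2 → Fin 2 → ℝ := fun i j k => pd k.rev (fun v => c.metric v i j) 0 with hK
  have hpd : ∀ p ∈ U, ∀ i j k, pd k (fun v => g v i j) p = pd k (fun v => c.metric v i j) 0 := by
    intro p hp i j k
    rw [pd_congr_of_eqOn hU (fun v hv => by rw [hgc v hv]) hp k, pd_metric, pd_metric]
  have eG : ∀ i j k, coeffG g u i j k = fun _ => K i j k := fun i j k => by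
    ext x; exact hpd _ (huU x) i j _
  have eC : ∀ i j k, coeffC Γ u i j k = fun _ => 1 / 2 * K i j k := fun i j k => by
    ext x; rw [coeffC, hΓg _ (huU x), hpd _ (huU x)]
  have eB : ∀ i j k, coeffB Γ u i j k = fun _ => 0 := fun i j k => by
    ext x
    refine Finset.sum_eq_zero fun m _ => ?_
    rw [pd_congr_of_eqOn hU (h := fun _ => 1 / 2 * pd m (fun v => c.metric v i j) 0)
      (fun v hv => by rw [hΓg v hv, hpd v hv]) (huU x)]
    simp [pd]
  have hsym : ∀ p q r, K p r q = K p q r ∧ K q p r = K p q r ∧ K r q p = K p q r := by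
    intro p q r
    simp only [hK, pd_metric]
    fin_cases p <;> fin_cases q <;> fin_cases r <;> simp [Fin.rev, Params.gradient]
  have hI := fun p q r => integral_cyclicTrilin_const (contDiff_component hψ₁ p)
    (hc₁.comp_left (g := fun v : Coord => v p) rfl) (contDiff_component hψ₂ q)
    (contDiff_component hψ₃ r)
  have hsum : ∀ x, bracketTerm (hydroOp g Γ) R3 u ψ₁ ψ₂ ψ₃ x
      + bracketTerm (hydroOp g Γ) R3 u ψ₂ ψ₃ ψ₁ x + bracketTerm (hydroOp g Γ) R3 u ψ₃ ψ₁ ψ₂ x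
      = ∑ p, ∑ q, ∑ r, K p q r * cyclicTrilin (fun _ => 1) (fun _ => 0) (fun _ => 1 / 2)
        (fun _ => 1) (fun _ => 0) (fun _ => 1 / 2) (fun _ => 1) (fun _ => 0) (fun _ => 1 / 2)
        (fun y => ψ₁ y p) (fun y => ψ₂ y q) (fun y => ψ₃ y r) x := by
    intro x
    rw [bracketTerm_cyclic hU hg hΓ hu huU hψ₁ hψ₂ hψ₃]
    refine Finset.sum_congr rfl fun p _ => Finset.sum_congr rfl fun q _ =>
      Finset.sum_congr rfl fun r _ => ?_
    obtain ⟨s1, s2, s3⟩ := hsym p q r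
    simp only [eG, eB, eC, s1, s2, s3, cyclicTrilin, trilin]
    ring
  simp only [hsum]
  have hint := fun p q r => ((hI p q r).1.const_mul (K p q r))
  rw [integral_finsetSum _ fun p _ => integrable_finsetSum _ fun q _ =>
    integrable_finsetSum _ fun r _ => hint p q r]
  refine Finset.sum_eq_zero fun p _ => ?_
  rw [integral_finsetSum _ fun q _ => integrable_finsetSum _ fun r _ => hint p q r]
  refine Finset.sum_eq_zero fun q _ => ?_
  rw [integral_finsetSum _ fun r _ => hint p q r]
  refine Finset.sum_eq_zero fun r _ => ?_
  rw [integral_const_mul, (hI p q r).2, mul_zero]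

end Smooth

/-! ### Levi-Civita connections of contravariant metrics in the plane -/

section Connection

variable {f h : Coord → ℝ} {u : Coord} {g : ContraTensor}

theorem pd_mul (hf : DifferentiableAt ℝ f u) (hh : DifferentiableAt ℝ h u) (k : Fin 2) :
    pd k (fun v => f v * h v) u = pd k f u * h u + f u * pd k h u := by
  rw [pd, (hf.hasFDerivAt.fun_mul hh.hasFDerivAt).fderiv]
  simp [pd]; ring

theorem pd_sub (hf : DifferentiableAt ℝ f u) (hh : DifferentiableAt ℝ h u) (k : Fin 2) :
    pd k (fun v => f v - h v) u = pd k f u - pd k h u := by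
  rw [pd, (hf.hasFDerivAt.fun_sub hh.hasFDerivAt).fderiv]
  simp [pd]

theorem pd_neg (k : Fin 2) : pd k (fun v => -f v) u = -pd k f u := by
  simp [pd, fderiv_fun_neg]

theorem pd_div (hf : DifferentiableAt ℝ f u) (hh : DifferentiableAt ℝ h u) (h0 : h u ≠ 0)
    (k : Fin 2) :
    pd k (fun v => f v / h v) u = (pd k f u * h u - f u * pd k h u) / h u ^ 2 := by
  have hq : DifferentiableAt ℝ (fun v => f v / h v) u := by
    simp only [div_eq_mul_inv]; exact hf.mul (hh.inv h0)
  have he : (fun v => f v / h v * h v) =ᶠ[𝓝 u] f := by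
    filter_upwards [hh.continuousAt.eventually_ne h0] with v hv
    exact div_mul_cancel₀ _ hv
  have hp := pd_mul hq hh k
  rw [pd, he.fderiv_eq, ← pd] at hp
  field_simp at hp ⊢
  linarith

/-- The entries of the inverse of a two-by-two matrix; for a singular matrix both sides are
zero. -/
theorem inv_fin_two (A : Matrix (Fin 2) (Fin 2) ℝ) (i j : Fin 2) :
    A⁻¹ i j = !![A 1 1, -A 0 1; -A 1 0, A 0 0] i j / (A 0 0 * A 1 1 - A 0 1 * A 1 0) := by
  rw [Matrix.inv_def, Ring.inverse_eq_inv', Matrix.adjugate_fin_two, Matrix.det_fin_two]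
  simp only [Matrix.smul_apply, smul_eq_mul]
  ring

/-- The derivative of the inverse matrix: `∂(g⁻¹) = - g⁻¹ (∂g) g⁻¹`. -/
theorem pd_inv_apply (hg : ∀ i j, DifferentiableAt ℝ (fun v => g v i j) u) (hd : (g u).det ≠ 0)
    (m i j : Fin 2) : pd m (fun v => (g v)⁻¹ i j) u
      = -∑ p, ∑ q, (g u)⁻¹ i p * pd m (fun v => g v p q) u * (g u)⁻¹ q j := by
  rw [Matrix.det_fin_two] at hd
  have hdd : DifferentiableAt ℝ (fun v => g v 0 0 * g v 1 1 - g v 0 1 * g v 1 0) u :=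
    ((hg 0 0).mul (hg 1 1)).sub ((hg 0 1).mul (hg 1 0))
  have hnum : ∀ i j, DifferentiableAt ℝ (fun v => !![g v 1 1, -g v 0 1; -g v 1 0, g v 0 0] i j) u
      := by
    intro i j
    fin_cases i <;> fin_cases j
    exacts [hg 1 1, (hg 0 1).neg, (hg 1 0).neg, hg 0 0]
  simp only [inv_fin_two]
  rw [pd_div (hnum i j) hdd hd, pd_sub ((hg 0 0).fun_mul (hg 1 1)) ((hg 0 1).fun_mul (hg 1 0)),
    pd_mul (hg 0 0) (hg 1 1), pd_mul (hg 0 1) (hg 1 0)]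
  obtain ⟨D, hD⟩ : ∃ D, D = g u 0 0 * g u 1 1 - g u 0 1 * g u 1 0 := ⟨_, rfl⟩
  rw [← hD] at hd ⊢
  fin_cases i <;> fin_cases j <;>
    simp [Fin.sum_univ_two, pd_neg] <;> field_simp <;> rw [hD] <;> ring

theorem christoffel_symm (hs : ∀ v, (g v).IsSymm) (i j k : Fin 2) :
    christoffel g i j k u = christoffel g i k j u := by
  have h : ∀ v, (g v)⁻¹ j k = (g v)⁻¹ k j := fun v => by
    have : ((g v)⁻¹).IsSymm := by
      rw [Matrix.IsSymm, Matrix.transpose_nonsing_inv, (hs v).eq]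
    exact this.apply k j
  unfold christoffel
  simp only [h]
  congr 1
  refine Finset.sum_congr rfl fun l _ => ?_
  ring

/-- The contravariant Christoffel symbols satisfy the first Levi-Civita condition: the Levi-Civita
connection is symmetric. -/
theorem contraChristoffel_symm (hs : ∀ v, (g v).IsSymm) (i j k : Fin 2) :
    ∑ s, g u i s * contraChristoffel g j k s u = ∑ s, g u j s * contraChristoffel g i k s u := by
  have h := christoffel_symm (u := u) hs k 0 1
  simp only [contraChristoffel, Fin.sum_univ_two, h]
  fin_cases i <;> fin_cases j <;> simp <;> ring

/-- The contravariant Christoffel symbols are half the gradient of `g` up to the defect of the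
first Levi-Civita condition for half the gradient. -/
theorem contraChristoffel_eq (hs : ∀ v, (g v).IsSymm)
    (hg : ∀ i j, DifferentiableAt ℝ (fun v => g v i j) u) (hd : (g u).det ≠ 0) (i j k : Fin 2) :
    contraChristoffel g i j k u = 1 / 2 * pd k (fun v => g v i j) u
      + 1 / 2 * ∑ m, (∑ s, (g u i s * pd s (fun v => g v j m) u
        - g u j s * pd s (fun v => g v i m) u)) * (g u)⁻¹ m k := by
  have h10 : ∀ v, g v 1 0 = g v 0 1 := fun v => (hs v).apply 0 1
  simp only [contraChristoffel, christoffel, pd_inv_apply hg hd]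
  rw [Matrix.det_fin_two] at hd
  simp only [Fin.sum_univ_two, inv_fin_two, h10]
  obtain ⟨D, hD⟩ : ∃ D, D = g u 0 0 * g u 1 1 - g u 0 1 * g u 0 1 := ⟨_, rfl⟩
  rw [h10, ← hD] at hd
  simp only [← hD]
  fin_cases i <;> fin_cases j <;> fin_cases k <;>
    simp [h10] <;> field_simp <;> rw [hD] <;> ring

end Connection

/-! ### The seven-parameter family: Levi-Civita conditions and flatness -/

theorem Params.metric_isSymm (c : Params) (u : Coord) : (c.metric u).IsSymm := by
  ext i j; fin_cases i <;> fin_cases j <;> rfl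

theorem Params.differentiable_metric (c : Params) (i j : Fin 2) :
    Differentiable ℝ (fun v => c.metric v i j) := by
  fin_cases i <;> fin_cases j <;> simp [Params.metric] <;> fun_prop

theorem Params.continuous_det_metric (c : Params) : Continuous (fun v => (c.metric v).det) := by
  simp only [Params.metric, Matrix.det_fin_two_of]
  fun_prop

theorem symm_of_inVariety {c : Params} (hc : c.InVariety) (u : Coord) (i j k : Fin 2) :
    ∑ s, c.metric u i s * c.gradient s j k = ∑ s, c.metric u j s * c.gradient s i k := by
  obtain ⟨h1, h2, h3⟩ := hc
  fin_cases i <;> fin_cases j <;> fin_cases k <;>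
    simp [Params.metric, Params.gradient, Fin.sum_univ_two]
  · linear_combination u 0 * h1 + h2
  · linear_combination -u 1 * h1 + h3
  · linear_combination -u 0 * h1 - h2
  · linear_combination u 1 * h1 - h3

/-- On a nonempty open set an affine function of one coordinate vanishes only if it is zero. -/
theorem eq_zero_of_affine_eq_zero {W : Set Coord} (hW : IsOpen W) (hne : W.Nonempty) {α γ : ℝ}
    (k : Fin 2) (h : ∀ u ∈ W, α * u k + γ = 0) : α = 0 ∧ γ = 0 := by
  obtain ⟨p, hp⟩ := hne
  obtain ⟨ε, hε, hball⟩ := Metric.isOpen_iff.mp hW p hp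
  have hq : p + Pi.single k (ε / 2) ∈ W := by
    apply hball
    rw [Metric.mem_ball, dist_eq_norm, add_sub_cancel_left, Pi.norm_single, Real.norm_eq_abs,
      abs_of_pos (by positivity)]
    linarith
  have e1 := h p hp
  have e2 := h _ hq
  simp only [Pi.add_apply, Pi.single_eq_same] at e2
  have hα : α * (ε / 2) = 0 := by linear_combination e2 - e1
  have : α = 0 := (mul_eq_zero.mp hα).resolve_right (by positivity)
  refine ⟨this, ?_⟩
  simpa [this] using e1

theorem inVariety_of_symm {c : Params} {W : Set Coord} (hW : IsOpen W) (hne : W.Nonempty)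
    (h : ∀ u ∈ W, ∀ i j k,
      ∑ s, c.metric u i s * c.gradient s j k = ∑ s, c.metric u j s * c.gradient s i k) :
    c.InVariety := by
  have h0 := eq_zero_of_affine_eq_zero hW hne (α := c.c1 * c.c4 - c.c2 * c.c6)
    (γ := c.c3 * c.c4 - c.c7 * c.c2) 0 fun u hu => by
      have := h u hu 0 1 0
      simp [Params.metric, Params.gradient, Fin.sum_univ_two] at this
      linear_combination this
  have h1 := eq_zero_of_affine_eq_zero hW hne (α := c.c2 * c.c6 - c.c1 * c.c4)
    (γ := c.c3 * c.c6 - c.c1 * c.c7) 1 fun u hu => by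
      have := h u hu 0 1 1
      simp [Params.metric, Params.gradient, Fin.sum_univ_two] at this
      linear_combination this
  exact ⟨h0.1, h0.2, h1.2⟩

theorem leviCivitaOn_iff {U : Set Coord} (hU : IsOpen U) (hne : U.Nonempty) {g : ContraTensor}
    {Γ : ContraSymbols} {c : Params} (hgc : ∀ u ∈ U, g u = c.metric u)
    (hΓ : ∀ u ∈ U, ∀ i j k, Γ u i j k = 1 / 2 * pd k (fun v => g v i j) u) :
    LeviCivitaOn U g Γ ↔ c.InVariety := by
  have hpd : ∀ u ∈ U, ∀ i j k, pd k (fun v => g v i j) u = c.gradient k i j := by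
    intro u hu i j k
    rw [pd_congr_of_eqOn hU (fun v hv => by rw [hgc v hv]) hu k, pd_metric]
  have hΓ' : ∀ u ∈ U, ∀ i j k, Γ u i j k = 1 / 2 * c.gradient k i j := fun u hu i j k => by
    rw [hΓ u hu, hpd u hu]
  constructor
  · rintro ⟨h, -⟩
    refine inVariety_of_symm hU hne fun u hu i j k => ?_
    have := h u hu i j k
    simp only [hΓ' u hu, hgc u hu, Fin.sum_univ_two] at this ⊢
    linarith
  · intro hc
    refine ⟨fun u hu i j k => ?_, fun u hu i j k => ?_⟩
    · have := symm_of_inVariety hc u i j k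
      simp only [hΓ' u hu, hgc u hu, Fin.sum_univ_two] at this ⊢
      linarith
    · rw [hΓ' u hu, hΓ' u hu, hpd u hu]
      have : c.gradient k j i = c.gradient k i j := by
        fin_cases i <;> fin_cases j <;> fin_cases k <;> rfl
      rw [this]; ring

theorem contraChristoffel_metric {c : Params} (hc : c.InVariety) {u : Coord}
    (hd : (c.metric u).det ≠ 0) (i j k : Fin 2) :
    contraChristoffel c.metric i j k u = 1 / 2 * c.gradient k i j := by
  rw [contraChristoffel_eq c.metric_isSymm (fun i j => c.differentiable_metric i j u) hd]
  simp only [pd_metric, Finset.sum_sub_distrib, symm_of_inVariety hc u i j, sub_self, zero_mul,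
    Finset.sum_const_zero, mul_zero, add_zero]

theorem christoffel_metric {c : Params} (hc : c.InVariety) {u : Coord}
    (hd : (c.metric u).det ≠ 0) (i l j : Fin 2) :
    christoffel c.metric i l j u
      = -(1 / 2) * ∑ p, (c.metric u)⁻¹ j p * c.gradient l p i := by
  rw [christoffel_symm c.metric_isSymm]
  have hu : IsUnit (c.metric u).det := isUnit_iff_ne_zero.mpr hd
  have h : c.metric u * Matrix.of (fun s t => christoffel c.metric t s l u)
      = -(1 / 2 : ℝ) • c.gradient l := by
    ext a b
    have := contraChristoffel_metric hc hd a b l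
    simp only [contraChristoffel] at this
    simp only [Matrix.mul_apply, Matrix.of_apply, Matrix.smul_apply, smul_eq_mul]
    linarith
  have h' : Matrix.of (fun s t => christoffel c.metric t s l u)
      = -(1 / 2 : ℝ) • ((c.metric u)⁻¹ * c.gradient l) := by
    rw [← Matrix.mul_smul, ← h, Matrix.nonsing_inv_mul_cancel_left _ _ hu]
  simpa only [Matrix.of_apply, Matrix.smul_apply, smul_eq_mul, Matrix.mul_apply] using
    congrFun (congrFun h' j) i

/-- The matrices `∂₀g` and `∂₁g` commute through `g⁻¹`; this is the integrability condition that
makes the curvature vanish. -/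
theorem gradient_comm {c : Params} (hc : c.InVariety) {u : Coord} (hd : (c.metric u).det ≠ 0) :
    (c.metric u)⁻¹ 0 0 * (c.c1 ^ 2 - c.c2 * c.c4) + (c.metric u)⁻¹ 1 1 * (c.c4 ^ 2 - c.c1 * c.c6)
      = 0 := by
  obtain ⟨h1, h2, h3⟩ := hc
  have hd' := hd
  rw [Matrix.det_fin_two] at hd'
  rw [inv_fin_two, inv_fin_two, ← Matrix.det_fin_two]
  field_simp
  simp [Params.metric]
  linear_combination (c.c4 * u 0 + c.c1 * u 1) * h1 + c.c4 * h2 - c.c1 * h3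

/-- The curvature is `¼ g⁻¹ (∂_k g g⁻¹ ∂_l g - ∂_l g g⁻¹ ∂_k g)`. -/
theorem flatOn_metric {c : Params} (hc : c.InVariety) (U : Set Coord) : FlatOn U c.metric := by
  intro u _ hd i j k l
  have hnear : ∀ᶠ v in 𝓝 u, (c.metric v).det ≠ 0 :=
    c.continuous_det_metric.continuousAt.eventually_ne hd
  have hdiff : ∀ p q, DifferentiableAt ℝ (fun v => (c.metric v)⁻¹ p q) u := by
    intro p q
    simp only [inv_fin_two, div_eq_mul_inv]
    have hD := c.differentiable_metric
    refine DifferentiableAt.mul ?_ (DifferentiableAt.inv (by fun_prop) ?_)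
    · fin_cases p <;> fin_cases q
      exacts [hD 1 1 u, (hD 0 1 u).neg, (hD 1 0 u).neg, hD 0 0 u]
    · rwa [← Matrix.det_fin_two]
  have hpd : ∀ m i l j, pd m (christoffel c.metric i l j) u
      = 1 / 2 * ∑ p, (∑ a, ∑ b, (c.metric u)⁻¹ j a * c.gradient m a b * (c.metric u)⁻¹ b p)
        * c.gradient l p i := by
    intro m i l j
    have he : christoffel c.metric i l j =ᶠ[𝓝 u]
        fun v => -(1 / 2) * ∑ p, (c.metric v)⁻¹ j p * c.gradient l p i := by
      filter_upwards [hnear] with v hv using christoffel_metric hc hv i l j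
    have hf : HasFDerivAt (fun v => -(1 / 2) * ∑ p, (c.metric v)⁻¹ j p * c.gradient l p i)
        (-(1 / 2 : ℝ) • ∑ p, c.gradient l p i • fderiv ℝ (fun v => (c.metric v)⁻¹ j p) u) u :=
      (HasFDerivAt.fun_sum fun p _ => (hdiff j p).hasFDerivAt.mul_const _).const_mul _
    have hq : ∀ p, fderiv ℝ (fun v => (c.metric v)⁻¹ j p) u (Pi.single m 1)
        = -∑ a, ∑ b, (c.metric u)⁻¹ j a * c.gradient m a b * (c.metric u)⁻¹ b p := fun p => by
      have := pd_inv_apply (fun i j => c.differentiable_metric i j u) hd m j p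
      simp only [pd_metric] at this
      exact this
    rw [pd, he.fderiv_eq, hf.fderiv]
    simp only [smul_apply, add_apply, hq, smul_eq_mul, Fin.sum_univ_two]
    ring
  have hsym : (c.metric u)⁻¹ 1 0 = (c.metric u)⁻¹ 0 1 := by
    simp [inv_fin_two, Params.metric]
  have e := gradient_comm hc hd
  have h1 := hc.1
  simp only [riemann, hpd, christoffel_metric hc hd, Fin.sum_univ_two]
  generalize (c.metric u)⁻¹ = h at *
  fin_cases k <;> fin_cases l <;> simp only [Fin.zero_eta, Fin.mk_one]
  · ring
  · fin_cases i <;> simp [Params.gradient, hsym]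
    · linear_combination -(1 / 4) * h j 1 * (e + h 0 1 * h1)
    · linear_combination 1 / 4 * h j 0 * (e + h 0 1 * h1)
  · fin_cases i <;> simp [Params.gradient, hsym]
    · linear_combination 1 / 4 * h j 1 * (e + h 0 1 * h1)
    · linear_combination -(1 / 4) * h j 0 * (e + h 0 1 * h1)
  · ring

/-- Flatness on an open set depends only on the values of the tensor there. -/
theorem flatOn_congr {U : Set Coord} (hU : IsOpen U) {g h : ContraTensor}
    (hgh : ∀ u ∈ U, g u = h u) : FlatOn U g ↔ FlatOn U h := by
  have hchr : ∀ i j k, ∀ u ∈ U, christoffel g i j k u = christoffel h i j k u := by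
    intro i j k u hu
    have hpd : ∀ m p q, pd m (fun v => (g v)⁻¹ p q) u = pd m (fun v => (h v)⁻¹ p q) u :=
      fun m p q => pd_congr_of_eqOn hU (fun v hv => by rw [hgh v hv]) hu m
    simp only [christoffel, hpd, hgh u hu]
  have hR : ∀ u ∈ U, ∀ i j k l, riemann g i j k l u = riemann h i j k l u := by
    intro u hu i j k l
    simp only [riemann, hchr _ _ _ u hu, pd_congr_of_eqOn hU (hchr _ _ _) hu]
  constructor <;> intro hf u hu hd i j k l
  · rw [← hR u hu]; exact hf u hu (by rwa [hgh u hu]) i j k l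
  · rw [hR u hu]; exact hf u hu (by rwa [← hgh u hu]) i j k l

/-! ### Lines in the variety and flat pencils -/

/-- The three bilinear forms polarizing the equations of the variety vanish on `(c, d)`. -/
def Params.Polar (c d : Params) : Prop :=
  c.c1 * d.c4 + d.c1 * c.c4 - c.c2 * d.c6 - d.c2 * c.c6 = 0 ∧
    c.c3 * d.c4 + d.c3 * c.c4 - c.c7 * d.c2 - d.c7 * c.c2 = 0 ∧
    c.c3 * d.c6 + d.c3 * c.c6 - c.c1 * d.c7 - d.c1 * c.c7 = 0

theorem inVariety_pencil_of_polar {c d : Params} (hc : c.InVariety) (hd : d.InVariety)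
    (h : c.Polar d) (lam : ℝ) : (c.pencil d lam).InVariety := by
  obtain ⟨a1, a2, a3⟩ := hc
  obtain ⟨b1, b2, b3⟩ := hd
  obtain ⟨h1, h2, h3⟩ := h
  refine ⟨?_, ?_, ?_⟩ <;> simp only [Params.pencil]
  · linear_combination a1 + lam ^ 2 * b1 - lam * h1
  · linear_combination a2 + lam ^ 2 * b2 - lam * h2
  · linear_combination a3 + lam ^ 2 * b3 - lam * h3

theorem polar_of_inVariety_pencil {c d : Params} (hc : c.InVariety) (hd : d.InVariety) {lam : ℝ}
    (h0 : lam ≠ 0) (h : (c.pencil d lam).InVariety) : c.Polar d := by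
  obtain ⟨a1, a2, a3⟩ := hc
  obtain ⟨b1, b2, b3⟩ := hd
  obtain ⟨h1, h2, h3⟩ := h
  simp only [Params.pencil] at h1 h2 h3
  refine ⟨?_, ?_, ?_⟩ <;> apply mul_left_cancel₀ h0
  · linear_combination a1 + lam ^ 2 * b1 - h1
  · linear_combination a2 + lam ^ 2 * b2 - h2
  · linear_combination a3 + lam ^ 2 * b3 - h3

theorem lineInVariety_iff_polar {c d : Params} (hc : c.InVariety) (hd : d.InVariety) :
    LineInVariety c d ↔ c.Polar d :=
  ⟨fun h => polar_of_inVariety_pencil hc hd one_ne_zero (h 1), inVariety_pencil_of_polar hc hd⟩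

theorem metric_pencil (c d : Params) (lam : ℝ) :
    (fun u => c.metric u - lam • d.metric u) = (c.pencil d lam).metric := by
  ext u i j
  fin_cases i <;> fin_cases j <;> simp [Params.metric, Params.pencil] <;> ring

theorem gradient_pencil (c d : Params) (lam : ℝ) (k i j : Fin 2) :
    (c.pencil d lam).gradient k i j = c.gradient k i j - lam * d.gradient k i j := by
  fin_cases k <;> fin_cases i <;> fin_cases j <;> simp [Params.gradient, Params.pencil]

theorem analyticOnNhd_det_metric (c : Params) :
    AnalyticOnNhd ℝ (fun v => (c.metric v).det) Set.univ := by
  intro u _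
  have h : ∀ k : Fin 2, AnalyticAt ℝ (fun v : Coord => v k) u := fun k =>
    (ContinuousLinearMap.proj (R := ℝ) (φ := fun _ : Fin 2 => ℝ) k).analyticAt u
  have aff : ∀ α β γ : ℝ, AnalyticAt ℝ (fun v : Coord => α * v 0 + β * v 1 + γ) u := fun α β γ =>
    ((analyticAt_const.mul (h 0)).add (analyticAt_const.mul (h 1))).add analyticAt_const
  simp only [Params.metric, Matrix.det_fin_two_of]
  exact ((aff _ _ _).mul (aff _ _ _)).sub ((aff _ _ _).mul (aff _ _ _))

/-- Two members of the family that are nondegenerate somewhere on an open set are nondegenerate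
at a common point of it. -/
theorem exists_common_nondegenerate {U : Set Coord} (hU : IsOpen U) {c d : Params}
    (hc : NondegenerateOn U c.metric) (hd : NondegenerateOn U d.metric) :
    ∃ u ∈ U, (c.metric u).det ≠ 0 ∧ (d.metric u).det ≠ 0 := by
  obtain ⟨p, hpU, hp⟩ := hc
  obtain ⟨q, hqU, hq⟩ := hd
  by_contra! hcon
  have hev : (fun v => (d.metric v).det) =ᶠ[𝓝 p] 0 := by
    filter_upwards [hU.mem_nhds hpU, c.continuous_det_metric.continuousAt.eventually_ne hp]
      with v hvU hv using hcon v hvU hv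
  exact hq ((analyticOnNhd_det_metric d).eqOn_zero_of_preconnected_of_eventuallyEq_zero
    isPreconnected_univ (Set.mem_univ p) hev (Set.mem_univ q))

/-- Where `g`, `h` and `g - λ h` are nondegenerate, linearity of the Christoffel symbols makes
those of `g - λ h` half its gradient. Symmetry of its Levi-Civita connection on an open set then
puts the parameters of `g - λ h` in the variety. One nonzero `λ` is enough, since the equations
are quadratic and hold for `g` and `h`. -/
theorem polar_of_flatParams {U : Set Coord} (hU : IsOpen U) {c d : Params} (hc : c.InVariety)
    (hd : d.InVariety) (hcn : NondegenerateOn U c.metric) (hdn : NondegenerateOn U d.metric)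
    (h : FlatParams U c d) : c.Polar d := by
  obtain ⟨p, hpU, hpc, hpd⟩ := exists_common_nondegenerate hU hcn hdn
  -- The pencil is nondegenerate at `p` for all small parameters, in particular for a nonzero one.
  obtain ⟨lam, hlam0, hlam⟩ : ∃ lam : ℝ, lam ≠ 0 ∧ ((c.pencil d lam).metric p).det ≠ 0 := by
    have hcont : Continuous (fun lam : ℝ => ((c.pencil d lam).metric p).det) := by
      simp only [← metric_pencil, Matrix.det_fin_two, Matrix.sub_apply, Matrix.smul_apply,
        smul_eq_mul]
      fun_prop
    have h0 : ((c.pencil d 0).metric p).det ≠ 0 := by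
      rw [← metric_pencil]; simpa using hpc
    have hev := (hcont.continuousAt (x := 0)).eventually_ne h0
    obtain ⟨lam, h1, h2⟩ := ((hev.filter_mono nhdsWithin_le_nhds).and
      (self_mem_nhdsWithin : {0}ᶜ ∈ 𝓝[≠] (0 : ℝ))).exists
    exact ⟨lam, h2, h1⟩
  refine polar_of_inVariety_pencil hc hd hlam0 ?_
  set e := c.pencil d lam with he
  have hW : IsOpen (U ∩ ({u | (c.metric u).det ≠ 0} ∩
      ({u | (d.metric u).det ≠ 0} ∩ {u | (e.metric u).det ≠ 0}))) :=
    hU.inter ((isOpen_ne_fun c.continuous_det_metric continuous_const).inter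
      ((isOpen_ne_fun d.continuous_det_metric continuous_const).inter
        (isOpen_ne_fun e.continuous_det_metric continuous_const)))
  refine inVariety_of_symm hW ⟨p, hpU, hpc, hpd, hlam⟩ ?_
  rintro u ⟨huU, huc, hud, hue⟩ i j k
  have hcontra : ∀ i j k, contraChristoffel e.metric i j k u = 1 / 2 * e.gradient k i j := by
    intro i j k
    have hm := congrFun (metric_pencil c d lam) u
    have := h.2 lam u huU huc hud (by rw [hm]; exact hue) i j k
    rw [metric_pencil, contraChristoffel_metric hc huc, contraChristoffel_metric hd hud] at this
    rw [this, gradient_pencil]; ring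
  have := contraChristoffel_symm (u := u) e.metric_isSymm i j k
  simp only [hcontra, Fin.sum_univ_two] at this ⊢
  linarith

theorem flatParams_of_lineInVariety {U : Set Coord} {c d : Params} (hc : c.InVariety)
    (hd : d.InVariety) (h : LineInVariety c d) : FlatParams U c d := by
  refine ⟨fun lam => ?_, fun lam u _ huc hud hue i j k => ?_⟩
  · rw [metric_pencil]; exact flatOn_metric (h lam) U
  · have hm := congrFun (metric_pencil c d lam) u
    rw [metric_pencil, contraChristoffel_metric hc huc, contraChristoffel_metric hd hud,
      contraChristoffel_metric (h lam) (by rw [← hm]; exact hue), gradient_pencil]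
    ring

theorem flatParams_iff_lineInVariety {U : Set Coord} (hU : IsOpen U) {c d : Params}
    (hc : c.InVariety) (hd : d.InVariety) (hcn : NondegenerateOn U c.metric)
    (hdn : NondegenerateOn U d.metric) : FlatParams U c d ↔ LineInVariety c d :=
  ⟨fun h => (lineInVariety_iff_polar hc hd).mpr (polar_of_flatParams hU hc hd hcn hdn h),
    flatParams_of_lineInVariety hc hd⟩

/-! ### The components of the variety and the lines between them -/

/-- The equations of the variety say that the vectors `(c₄, c₆, c₇)` and `(c₂, c₁, c₃)` are
proportional. -/
theorem Params.Case1.exists_ratio {c : Params} (h : c.Case1) :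
    ∃ α, c.c4 = α * c.c2 ∧ c.c6 = α * c.c1 ∧ c.c7 = α * c.c3 := by
  obtain ⟨h2, h6, h7⟩ := h
  refine ⟨c.c4 / c.c2, ?_, ?_, ?_⟩
  · field_simp
  · rw [h6]; ring
  · rw [h7]; ring

theorem Params.Case2.exists_ratio {c : Params} (h : c.Case2) :
    ∃ α, c.c6 = α * c.c1 ∧ c.c7 = α * c.c3 := by
  obtain ⟨-, h3, h6, -⟩ := h
  refine ⟨c.c7 / c.c3, ?_, ?_⟩
  · rw [h6]; ring
  · field_simp

theorem Params.Case1.inVariety {c : Params} (h : c.Case1) : c.InVariety := by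
  obtain ⟨α, h4, h6, h7⟩ := h.exists_ratio
  simp only [Params.InVariety, h4, h6, h7]
  refine ⟨by ring, by ring, by ring⟩

theorem Params.Case2.inVariety {c : Params} (h : c.Case2) : c.InVariety := by
  obtain ⟨α, h6, h7⟩ := h.exists_ratio
  simp only [Params.InVariety, h6, h7, h.1, h.2.2.2]
  refine ⟨by ring, by ring, by ring⟩

theorem Params.Case3.inVariety {c : Params} (h : c.Case3) : c.InVariety := by
  obtain ⟨h3, h2, h1⟩ := h
  simp [Params.InVariety, h3, h2, h1]

theorem Params.Case4.inVariety {c : Params} (h : c.Case4) : c.InVariety := by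
  obtain ⟨h3, h2, -, h4, h7⟩ := h
  simp [Params.InVariety, h3, h2, h4, h7]

theorem Params.inVariety_iff_cases (c : Params) :
    c.InVariety ↔ c.Case1 ∨ c.Case2 ∨ c.Case3 ∨ c.Case4 := by
  constructor
  · rintro ⟨e1, e2, e3⟩
    by_cases h2 : c.c2 = 0
    · rw [h2] at e1 e2
      by_cases h3 : c.c3 = 0
      · rw [h3] at e3
        by_cases h1 : c.c1 = 0
        · exact Or.inr (Or.inr (Or.inl ⟨h3, h2, h1⟩))
        · refine Or.inr (Or.inr (Or.inr ⟨h3, h2, h1, ?_, ?_⟩)) <;> apply mul_left_cancel₀ h1 <;>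
            linarith
      · refine Or.inr (Or.inl ⟨h2, h3, ?_, ?_⟩)
        · rw [eq_div_iff h3]; linarith
        · apply mul_left_cancel₀ h3; linarith
    · refine Or.inl ⟨h2, ?_, ?_⟩ <;> rw [eq_div_iff h2] <;> linarith
  · rintro (h | h | h | h)
    exacts [h.inVariety, h.inVariety, h.inVariety, h.inVariety]

section Lines

variable {c d : Params}

theorem line_case1_case1 (hc : c.Case1) (hd : d.Case1) : LineInVariety c d ↔
    c.c4 = d.c4 * c.c2 / d.c2 ∨
      (d.c3 = d.c2 * c.c3 / c.c2 ∧ c.c1 = d.c1 * c.c2 / d.c2) := by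
  rw [lineInVariety_iff_polar hc.inVariety hd.inVariety]
  obtain ⟨α, h4, h6, h7⟩ := hc.exists_ratio
  obtain ⟨β, k4, k6, k7⟩ := hd.exists_ratio
  have hc2 := hc.1
  have hd2 := hd.1
  simp only [Params.Polar, h4, h6, h7, k4, k6, k7]
  rw [eq_div_iff hd2, eq_div_iff hc2, eq_div_iff hd2]
  constructor
  · rintro ⟨e1, e2, -⟩
    by_cases h : β - α = 0
    · left; linear_combination -c.c2 * d.c2 * h
    · refine Or.inr ⟨?_, ?_⟩ <;> apply mul_left_cancel₀ h
      · linear_combination -e2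
      · linear_combination e1
  · rintro (h | ⟨e1, e2⟩)
    · have : α = β := by
        apply mul_right_cancel₀ (mul_ne_zero hc2 hd2); linear_combination h
      subst this
      refine ⟨by ring, by ring, by ring⟩
    · refine ⟨?_, ?_, ?_⟩
      · linear_combination (β - α) * e2
      · linear_combination -(β - α) * e1
      · apply mul_left_cancel₀ (mul_ne_zero hc2 hd2)
        linear_combination (β - α) * (c.c3 * d.c2 * (-e2) - c.c1 * d.c2 * e1)

theorem line_case1_case2 (hc : c.Case1) (hd : d.Case2) :
    LineInVariety c d ↔ d.c7 = d.c3 * c.c4 / c.c2 := by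
  rw [lineInVariety_iff_polar hc.inVariety hd.inVariety]
  obtain ⟨α, h4, h6, h7⟩ := hc.exists_ratio
  obtain ⟨β, k6, k7⟩ := hd.exists_ratio
  obtain ⟨k2, hd3, -, k4⟩ := hd
  have hc2 := hc.1
  simp only [Params.Polar, h4, h6, h7, k2, k4, k6, k7]
  rw [eq_div_iff hc2]
  constructor
  · rintro ⟨-, e2, -⟩
    linear_combination -e2
  · intro h
    have : α = β := by
      apply mul_right_cancel₀ (mul_ne_zero hc2 hd3); linear_combination -h
    subst this
    refine ⟨by ring, by ring, by ring⟩

theorem line_case1_case3 (hc : c.Case1) (hd : d.Case3) :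
    LineInVariety c d ↔ d.c6 = d.c4 * c.c1 / c.c2 ∧ d.c7 = d.c4 * c.c3 / c.c2 := by
  rw [lineInVariety_iff_polar hc.inVariety hd.inVariety]
  obtain ⟨k3, k2, k1⟩ := hd
  have hc2 := hc.1
  simp only [Params.Polar, k1, k2, k3]
  rw [eq_div_iff hc2, eq_div_iff hc2]
  constructor
  · rintro ⟨e1, e2, -⟩
    exact ⟨by linear_combination -e1, by linear_combination -e2⟩
  · rintro ⟨e1, e2⟩
    refine ⟨by linear_combination -e1, by linear_combination -e2, ?_⟩
    apply mul_left_cancel₀ hc2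
    linear_combination c.c3 * e1 - c.c1 * e2

theorem line_case1_case4 (hc : c.Case1) (hd : d.Case4) :
    LineInVariety c d ↔ d.c6 = c.c4 * d.c1 / c.c2 := by
  rw [lineInVariety_iff_polar hc.inVariety hd.inVariety]
  obtain ⟨α, h4, h6, h7⟩ := hc.exists_ratio
  obtain ⟨k3, k2, -, k4, k7⟩ := hd
  have hc2 := hc.1
  simp only [Params.Polar, h4, h6, h7, k2, k3, k4, k7]
  rw [eq_div_iff hc2]
  constructor
  · rintro ⟨e1, -, -⟩
    linear_combination -e1
  · intro h
    have h' : d.c6 = α * d.c1 := by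
      apply mul_right_cancel₀ hc2; linear_combination h
    rw [h']
    refine ⟨by ring, by ring, by ring⟩

theorem line_case2_case2 (hc : c.Case2) (hd : d.Case2) :
    LineInVariety c d ↔ d.c7 = d.c3 * c.c7 / c.c3 ∨ d.c1 = d.c3 * c.c1 / c.c3 := by
  rw [lineInVariety_iff_polar hc.inVariety hd.inVariety]
  obtain ⟨α, h6, h7⟩ := hc.exists_ratio
  obtain ⟨β, k6, k7⟩ := hd.exists_ratio
  obtain ⟨h2, hc3, -, h4⟩ := hc
  obtain ⟨k2, hd3, -, k4⟩ := hd
  simp only [Params.Polar, h2, h4, h6, h7, k2, k4, k6, k7]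
  rw [eq_div_iff hc3, eq_div_iff hc3]
  constructor
  · rintro ⟨-, -, e3⟩
    by_cases h : β - α = 0
    · left; linear_combination d.c3 * c.c3 * h
    · right; apply mul_left_cancel₀ h; linear_combination e3
  · rintro (h | h)
    · have : β = α := by
        apply mul_right_cancel₀ (mul_ne_zero hc3 hd3); linear_combination h
      subst this
      refine ⟨by ring, by ring, by ring⟩
    · exact ⟨by ring, by ring, by linear_combination (β - α) * h⟩

theorem line_case2_case3 (hc : c.Case2) (hd : d.Case3) :
    LineInVariety c d ↔ d.c4 = 0 ∧ d.c6 = d.c7 * c.c1 / c.c3 := by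
  rw [lineInVariety_iff_polar hc.inVariety hd.inVariety]
  obtain ⟨h2, hc3, -, h4⟩ := hc
  obtain ⟨k3, k2, k1⟩ := hd
  simp only [Params.Polar, h2, h4, k1, k2, k3]
  rw [eq_div_iff hc3]
  constructor
  · rintro ⟨-, e2, e3⟩
    refine ⟨?_, by linear_combination e3⟩
    apply mul_left_cancel₀ hc3; linear_combination e2
  · rintro ⟨e2, e3⟩
    rw [e2]
    exact ⟨by ring, by ring, by linear_combination e3⟩

theorem line_case2_case4 (hc : c.Case2) (hd : d.Case4) :
    LineInVariety c d ↔ d.c6 = c.c7 * d.c1 / c.c3 := by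
  rw [lineInVariety_iff_polar hc.inVariety hd.inVariety]
  obtain ⟨h2, hc3, -, h4⟩ := hc
  obtain ⟨k3, k2, -, k4, k7⟩ := hd
  simp only [Params.Polar, h2, h4, k2, k3, k4, k7]
  rw [eq_div_iff hc3]
  constructor
  · rintro ⟨-, -, e3⟩
    linear_combination e3
  · intro e3
    exact ⟨by ring, by ring, by linear_combination e3⟩

theorem line_case3_case3 (hc : c.Case3) (hd : d.Case3) : LineInVariety c d := by
  rw [lineInVariety_iff_polar hc.inVariety hd.inVariety]
  obtain ⟨h3, h2, h1⟩ := hc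
  obtain ⟨k3, k2, k1⟩ := hd
  simp [Params.Polar, h1, h2, h3, k1, k2, k3]

theorem line_case3_case4 (hc : c.Case3) (hd : d.Case4) :
    LineInVariety c d ↔ c.c4 = 0 ∧ c.c7 = 0 := by
  rw [lineInVariety_iff_polar hc.inVariety hd.inVariety]
  obtain ⟨h3, h2, h1⟩ := hc
  obtain ⟨k3, k2, k1, k4, k7⟩ := hd
  simp [Params.Polar, h1, h2, h3, k1, k2, k3, k4, k7]

theorem line_case4_case4 (hc : c.Case4) (hd : d.Case4) : LineInVariety c d := by
  rw [lineInVariety_iff_polar hc.inVariety hd.inVariety]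
  obtain ⟨h3, h2, -, h4, h7⟩ := hc
  obtain ⟨k3, k2, -, k4, k7⟩ := hd
  simp [Params.Polar, h2, h3, h4, h7, k2, k3, k4, k7]

end Lines

end KdVTrio

theorem mainTheorem5 (U : Set Coord) (hU : IsOpen U) (hUc : IsConnected U) :
    -- the operators compatible with `R3`
    (∀ (g : ContraTensor) (Γ : ContraSymbols),
      (∀ i j, ContDiffOn ℝ ∞ (fun u => g u i j) U) →
      (∀ i j k, ContDiffOn ℝ ∞ (fun u => Γ u i j k) U) →
      (∀ u ∈ U, (g u).IsSymm) →
      (Compatible U (hydroOp g Γ) R3 ↔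
        ∃ c : Params, (∀ u ∈ U, g u = c.metric u) ∧
          ∀ u ∈ U, ∀ i j k, Γ u i j k = 1 / 2 * pd k (fun v => g v i j) u) ∧
      -- for them, the Levi-Civita conditions are quadratic equations that imply flatness
      (Compatible U (hydroOp g Γ) R3 →
        ∀ c : Params, (∀ u ∈ U, g u = c.metric u) →
          (LeviCivitaOn U g Γ ↔ c.InVariety) ∧ (c.InVariety → FlatOn U g))) ∧
    -- the solution of the quadratic system
    (∀ c : Params, c.InVariety ↔ c.Case1 ∨ c.Case2 ∨ c.Case3 ∨ c.Case4) ∧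
    -- flat pencils are the lines contained in the variety
    (∀ c d : Params, c.InVariety → d.InVariety →
      NondegenerateOn U c.metric → NondegenerateOn U d.metric →
      (FlatParams U c d ↔ LineInVariety c d)) ∧
    -- the list of flat pencils
    (∀ c d : Params, NondegenerateOn U c.metric → NondegenerateOn U d.metric →
      (c.Case1 → d.Case1 → (FlatParams U c d ↔
        c.c4 = d.c4 * c.c2 / d.c2 ∨
          (d.c3 = d.c2 * c.c3 / c.c2 ∧ c.c1 = d.c1 * c.c2 / d.c2))) ∧
      (c.Case1 → d.Case2 → (FlatParams U c d ↔ d.c7 = d.c3 * c.c4 / c.c2)) ∧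
      (c.Case1 → d.Case3 → (FlatParams U c d ↔
        d.c6 = d.c4 * c.c1 / c.c2 ∧ d.c7 = d.c4 * c.c3 / c.c2)) ∧
      (c.Case1 → d.Case4 → (FlatParams U c d ↔ d.c6 = c.c4 * d.c1 / c.c2)) ∧
      (c.Case2 → d.Case2 → (FlatParams U c d ↔
        d.c7 = d.c3 * c.c7 / c.c3 ∨ d.c1 = d.c3 * c.c1 / c.c3)) ∧
      (c.Case2 → d.Case3 → (FlatParams U c d ↔ d.c4 = 0 ∧ d.c6 = d.c7 * c.c1 / c.c3)) ∧
      (c.Case2 → d.Case4 → (FlatParams U c d ↔ d.c6 = c.c7 * d.c1 / c.c3)) ∧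
      (c.Case3 → d.Case3 → FlatParams U c d) ∧
      (c.Case3 → d.Case4 → (FlatParams U c d ↔ c.c4 = 0 ∧ c.c7 = 0)) ∧
      (c.Case4 → d.Case4 → FlatParams U c d)) ∧
    -- the list of lines in the variety, degenerate parameters included
    (∀ c d : Params,
      (c.Case1 → d.Case1 → (LineInVariety c d ↔
        c.c4 = d.c4 * c.c2 / d.c2 ∨
          (d.c3 = d.c2 * c.c3 / c.c2 ∧ c.c1 = d.c1 * c.c2 / d.c2))) ∧
      (c.Case1 → d.Case2 → (LineInVariety c d ↔ d.c7 = d.c3 * c.c4 / c.c2)) ∧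
      (c.Case1 → d.Case3 → (LineInVariety c d ↔
        d.c6 = d.c4 * c.c1 / c.c2 ∧ d.c7 = d.c4 * c.c3 / c.c2)) ∧
      (c.Case1 → d.Case4 → (LineInVariety c d ↔ d.c6 = c.c4 * d.c1 / c.c2)) ∧
      (c.Case2 → d.Case2 → (LineInVariety c d ↔
        d.c7 = d.c3 * c.c7 / c.c3 ∨ d.c1 = d.c3 * c.c1 / c.c3)) ∧
      (c.Case2 → d.Case3 → (LineInVariety c d ↔ d.c4 = 0 ∧ d.c6 = d.c7 * c.c1 / c.c3)) ∧
      (c.Case2 → d.Case4 → (LineInVariety c d ↔ d.c6 = c.c7 * d.c1 / c.c3)) ∧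
      (c.Case3 → d.Case3 → LineInVariety c d) ∧
      (c.Case3 → d.Case4 → (LineInVariety c d ↔ c.c4 = 0 ∧ c.c7 = 0)) ∧
      (c.Case4 → d.Case4 → LineInVariety c d)) := by 
  refine ⟨fun g Γ hg hΓ hs => ⟨⟨fun h => ?_, ?_⟩, fun h c hgc => ⟨?_, fun hc => ?_⟩⟩,
    Params.inVariety_iff_cases, fun c d hc hd => flatParams_iff_lineInVariety hU hc hd,
    fun c d hcn hdn => ?_, fun c d => ⟨line_case1_case1, line_case1_case2, line_case1_case3,
      line_case1_case4, line_case2_case2, line_case2_case3, line_case2_case4, line_case3_case3,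
      line_case3_case4, line_case4_case4⟩⟩
  · obtain ⟨⟨c, hc⟩, hΓg⟩ := exists_params_of_compatible hU hUc hg hΓ hs h
    exact ⟨c, hc, hΓg⟩
  · rintro ⟨c, hgc, hΓg⟩
    exact compatible_of_params hU hg hΓ hgc hΓg
  · exact leviCivitaOn_iff hU hUc.nonempty hgc (exists_params_of_compatible hU hUc hg hΓ hs h).2
  · exact (flatOn_congr hU hgc).mpr (flatOn_metric hc U)
  · have key : c.InVariety → d.InVariety → (FlatParams U c d ↔ LineInVariety c d) := fun hc hd =>
      flatParams_iff_lineInVariety hU hc hd hcn hdn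
    exact ⟨fun hc hd => (key hc.inVariety hd.inVariety).trans (line_case1_case1 hc hd),
      fun hc hd => (key hc.inVariety hd.inVariety).trans (line_case1_case2 hc hd),
      fun hc hd => (key hc.inVariety hd.inVariety).trans (line_case1_case3 hc hd),
      fun hc hd => (key hc.inVariety hd.inVariety).trans (line_case1_case4 hc hd),
      fun hc hd => (key hc.inVariety hd.inVariety).trans (line_case2_case2 hc hd),
      fun hc hd => (key hc.inVariety hd.inVariety).trans (line_case2_case3 hc hd),
      fun hc hd => (key hc.inVariety hd.inVariety).trans (line_case2_case4 hc hd),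
      fun hc hd => (key hc.inVariety hd.inVariety).mpr (line_case3_case3 hc hd),
      fun hc hd => (key hc.inVariety hd.inVariety).trans (line_case3_case4 hc hd),
      fun hc hd => (key hc.inVariety hd.inVariety).mpr (line_case4_case4 hc hd)⟩
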